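/- **Setting.** Let $\Omega\subset\mathbb R^2$ be a bounded domain with polygonal boundary $\Gamma$ (lying on one side of its boundary), let $\Gamma_D,\Gamma_N$ be disjoint relatively open subsets of $\Gamma$ of positive length with $\Gamma=\overline\Gamma_D\cup\overline\Gamma_N$, and let $\kappa\in[L^\infty(\Omega)]^{2\times2}$ be uniformly positive definite. Let $f\in L^2(\Omega)$, $g\in H^{1/2}(\Gamma_D)$, $H=\{\tau\in H(\mathrm{div};\Omega):\tau\cdot\nu=0\text{ on }\Gamma_N\}$, $Q=L^2(\Omega)$, and let $(\sigma,u)\in H\times Q$ be the solution of $$\int_\Omega\kappa^{-1}\sigma\cdot\tau+\int_\Omega u\,\mathrm{div}\,\tau=\langle\tau\cdot\nu,g\rangle_{\Gamma_D}\quad\forall\tau\in H,\qquad \int_\Omega v\,\mathrm{div}\,\sigma=-\int_\Omega fv\quad\forall v\in Q .$$ **Meshes.** Let $C_{\mathcal T}>0$, and let $\mathcal T_h$ be a finite decomposition of $\Omega$ into open non-overlapping simple polygons $K$ (angles equal to $\pi$ allowed) each of whose edges lies, up to its end points, in $\Omega$, $\Gamma_D$ or $\Gamma_N$. With $h_K$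 the diameter of $K$ and $h_e$ the length of an edge $e$, assume for each $K\in\mathcal T_h$ that $h_e\ge C_{\mathcal T}h_K$ for every edge $e$ of $K$, and that $K$ is star-shaped with respect to a ball of radius $C_{\mathcal T}h_K$ centred in $K$. **Discretization.** Let $k\ge0$, $\mathrm P_{-1}=\{0\}$, and let $\mathbf\Pi^0_k$ be the $L^2(K)$-orthogonal projection onto $[\mathrm P_k(K)]^2$. Let $$H_h^K=\{\tau\in H(\mathrm{div};K)\cap H(\mathrm{rot};K):\ \tau\cdot\nu|_e\in\mathrm P_k(e)\ \forall\text{ edges } e \text{ of } K,\ \mathrm{div}\,\tau\in\mathrm P_k(K),\ \mathrm{rot}\,\tau\in\mathrm P_{k-1}(K)\},$$ $H_h=\{\tau\in H:\tau|_K\in H_h^K\ \forall K\in\mathcal T_h\}$ and $Q_h=\{v\in Q:v|_K\in\mathrm P_k(K)\ \forall K\in\mathcal T_h\}$. Put $a^K(\zeta,\tau)=\int_K\kappa^{-1}\zeta\cdot\tau$ and $$a_h^K(\zeta,\tau)=a^K(\mathbf\Pi^0_k\zeta,\mathbf\Pi^0_k\tau)+\mathcal S^K(\zeta-\mathbf\Pi^0_k\zeta,\tau-\mathbf\Pi^0_k\tau),$$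 where $\mathcal S^K$ is any symmetric positive definite bilinear form on $H_h^K$ with $\hat c_0a^K(\zeta,\zeta)\le\mathcal S^K(\zeta,\zeta)\le\hat c_1a^K(\zeta,\zeta)$ whenever $\mathbf\Pi^0_k\zeta=0$, with constants $\hat c_0,\hat c_1>0$ independent of $K$. Let $(\sigma_h,u_h)\in H_h\times Q_h$ solve $$\sum_{K}a_h^K(\sigma_h,\tau_h)+\int_\Omega u_h\,\mathrm{div}\,\tau_h=\langle\tau_h\cdot\nu,g\rangle_{\Gamma_D}\quad\forall\tau_h\in H_h,\qquad\int_\Omega v_h\,\mathrm{div}\,\sigma_h=-\int_\Omega fv_h\quad\forall v_h\in Q_h,$$ and let $\sigma_h^\star|_K\in[\mathrm P_{k+1}(K)]^2$ be the postprocessed flux, defined on each $K$ by $$\int_K\sigma_h^\star\cdot\tau+\int_K\mathrm{div}\,\sigma_h^\star\,\mathrm{div}\,\tau=\int_K\mathbf\Pi_k^0\sigma_h\cdot\tau+\int_K\mathrm{div}\,\sigma_h\,\mathrm{div}\,\tau\qquad\forall\tau\in[\mathrm P_{k+1}(K)]^2 .$$ Finally let $\kappa_h$ be a matrix-valued function,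 polynomial of degree at most a fixed $m\ge0$ on each $K\in\mathcal T_h$ (in practice an approximation of $\kappa^{-1}$). **Statement (local efficiency of $\eta_{1,K}$ and $\eta_{2,K}$).** There is a constant $C>0$, depending at most on $\Omega,\Gamma_D,\Gamma_N,\kappa,k,m,C_{\mathcal T},\hat c_0,\hat c_1$ (in particular independent of the mesh, of $h$, of $f$ and of $g$), such that for every such mesh and all $K\in\mathcal T_h$ $$h_K^2\|\kappa_h\sigma_h^\star-\nabla u_h\|_{0,K}^2\le C\Big\{h_K^2\|\sigma-\sigma_h^\star\|_{0,K}^2+h_K^2\|(\kappa^{-1}-\kappa_h)\sigma_h^\star\|_{0,K}^2+\|u-u_h\|_{0,K}^2\Big\},$$ and for every edge $e$ of $K$ lying on $\Gamma_D$ $$h_e\|g-u_h\|_{0,e}^2\le C\Big\{h_K^2\|\sigma-\sigma_h^\star\|_{0,K}^2+h_K^2\|(\kappa^{-1}-\kappa_h)\sigma_h^\star\|_{0,K}^2+\|u-u_h\|_{0,K}^2\Big\},$$ where on $e$ the function $u_h$ is the boundary value of $u_h|_K$. -/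

import Mathlib

open MeasureTheory Filter Topology

namespace MixedVEM

noncomputable section

/-! ### The plane, polynomials, Sobolev notions -/

/-- The Euclidean plane. -/
abbrev Plane : Type := EuclideanSpace ℝ (Fin 2)

/-- Scalar polynomials in two variables. -/
abbrev Poly2 : Type := MvPolynomial (Fin 2) ℝ

/-- Vector polynomials in two variables. -/
abbrev VPoly2 : Type := Fin 2 → Poly2

/-- Every monomial of `p` has total degree `< n`, i.e. `p` lies in `P_{n-1}`, with `P_{-1} = {0}`. -/
def DegLT (n : ℕ) (p : Poly2) : Prop := ∀ α ∈ p.support, Finsupp.degree α < n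

/-- Both components lie in `P_{n-1}`. -/
def VDegLT (n : ℕ) (p : VPoly2) : Prop := ∀ i, DegLT n (p i)

/-- The polynomial function of `p`. -/
def ev (p : Poly2) (x : Plane) : ℝ := MvPolynomial.eval (fun i => x i) p

/-- The polynomial vector field of `p`. -/
def vev (p : VPoly2) (x : Plane) : Plane := WithLp.toLp 2 (fun i => ev (p i) x)

/-- Gradient of a polynomial. -/
def polyGrad (p : Poly2) : VPoly2 := fun i => MvPolynomial.pderiv i p

/-- Divergence of a vector polynomial. -/
def polyDiv (p : VPoly2) : Poly2 := MvPolynomial.pderiv 0 (p 0) + MvPolynomial.pderiv 1 (p 1)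

/-- Matrix times vector in the Euclidean plane. -/
def mulV (A : Matrix (Fin 2) (Fin 2) ℝ) (v : Plane) : Plane :=
  WithLp.toLp 2 (A.mulVec v.ofLp)

/-- Product of a polynomial matrix and a polynomial vector. -/
def polyMulV (A : Matrix (Fin 2) (Fin 2) Poly2) (p : VPoly2) : VPoly2 := A.mulVec p

/-- Lebesgue measure on `U`. -/
abbrev area (U : Set Plane) : Measure Plane := volume.restrict U

/-- Arc length (one-dimensional Hausdorff measure) on `S`. -/
abbrev arc (S : Set Plane) : Measure Plane := (Measure.hausdorffMeasure 1 : Measure Plane).restrict S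

/-- Smooth functions on the whole plane. -/
def Smooth (φ : Plane → ℝ) : Prop := ContDiff ℝ (⊤ : ℕ∞) φ

/-- `φ ∈ C_c^∞(U)`. -/
def IsTest (U : Set Plane) (φ : Plane → ℝ) : Prop :=
  Smooth φ ∧ HasCompactSupport φ ∧ tsupport φ ⊆ U

/-- `w ∈ H¹(U)` with weak gradient `Dw`. -/
def HasGradL2 (U : Set Plane) (w : Plane → ℝ) (Dw : Plane → Plane) : Prop :=
  MemLp w 2 (area U) ∧ MemLp Dw 2 (area U) ∧
    ∀ φ, IsTest U φ → ∀ i : Fin 2,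
      ∫ x in U, w x * gradient φ x i = - ∫ x in U, Dw x i * φ x

/-- `τ ∈ H(div; U)` with weak divergence `d`. -/
def HasDivL2 (U : Set Plane) (τ : Plane → Plane) (d : Plane → ℝ) : Prop :=
  MemLp τ 2 (area U) ∧ MemLp d 2 (area U) ∧
    ∀ φ, IsTest U φ → ∫ x in U, inner ℝ (τ x) (gradient φ x) = - ∫ x in U, d x * φ x

/-- `τ ∈ H(rot; U)` with weak rotation `r = ∂₁τ₂ - ∂₂τ₁`. -/
def HasRotL2 (U : Set Plane) (τ : Plane → Plane) (r : Plane → ℝ) : Prop :=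
  MemLp τ 2 (area U) ∧ MemLp r 2 (area U) ∧
    ∀ φ, IsTest U φ →
      ∫ x in U, (τ x 1 * gradient φ x 0 - τ x 0 * gradient φ x 1) = - ∫ x in U, r x * φ x

/-- The function `w ∈ H¹(U)` (with weak gradient `Dw`) has trace `g ∈ L²(S)` on the boundary piece
`S`: the trace operator is the continuous extension of the restriction of smooth functions. -/
def HasTrace (U S : Set Plane) (w : Plane → ℝ) (Dw : Plane → Plane) (g : Plane → ℝ) : Prop :=
  HasGradL2 U w Dw ∧ MemLp g 2 (arc S) ∧
    ∃ φ : ℕ → Plane → ℝ, (∀ n, Smooth (φ n)) ∧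
      Tendsto (fun n => eLpNorm (fun x => φ n x - w x) 2 (area U)) atTop (𝓝 0) ∧
      Tendsto (fun n => eLpNorm (fun x => gradient (φ n) x - Dw x) 2 (area U)) atTop (𝓝 0) ∧
      Tendsto (fun n => eLpNorm (fun x => φ n x - g x) 2 (arc S)) atTop (𝓝 0)

theorem Smooth.integrable_gradient {U : Set Plane} {φ : Plane → ℝ} (h : IsTest U φ) :
    MemLp (gradient φ) 2 (area U) ∧ MemLp φ 2 (area U) := by
  have hc : Continuous (gradient φ) := by
    have : Continuous (fderiv ℝ φ) := h.1.continuous_fderiv (by simp)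
    exact (InnerProductSpace.toDual ℝ Plane).symm.continuous.comp this
  have hs : HasCompactSupport (gradient φ) := by
    have : HasCompactSupport (fderiv ℝ φ) := h.2.1.fderiv ℝ
    exact this.comp_left (g := (InnerProductSpace.toDual ℝ Plane).symm) (by simp)
  exact ⟨(hc.memLp_of_hasCompactSupport hs).restrict _,
    (h.1.continuous.memLp_of_hasCompactSupport h.2.1).restrict _⟩

theorem MemLp.coord {μ : Measure Plane} {F : Plane → Plane} (h : MemLp F 2 μ) (i : Fin 2) :
    MemLp (fun x => F x i) 2 μ :=
  h.continuousLinearMap_comp (EuclideanSpace.proj i : Plane →L[ℝ] ℝ)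

theorem HasGradL2.sub {U : Set Plane} {w w' : Plane → ℝ} {D D' : Plane → Plane}
    (h : HasGradL2 U w D) (h' : HasGradL2 U w' D') :
    HasGradL2 U (fun x => w x - w' x) (fun x => D x - D' x) := by
  refine ⟨h.1.sub h'.1, h.2.1.sub h'.2.1, fun φ hφ i => ?_⟩
  obtain ⟨hg, hp⟩ := Smooth.integrable_gradient hφ
  have hgi := MemLp.coord hg i
  have e1 := h.2.2 φ hφ i
  have e2 := h'.2.2 φ hφ i
  have i1 : Integrable (fun x => w x * gradient φ x i) (area U) := h.1.integrable_mul hgi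
  have i2 : Integrable (fun x => w' x * gradient φ x i) (area U) := h'.1.integrable_mul hgi
  have i3 : Integrable (fun x => D x i * φ x) (area U) := (MemLp.coord h.2.1 i).integrable_mul hp
  have i4 : Integrable (fun x => D' x i * φ x) (area U) := (MemLp.coord h'.2.1 i).integrable_mul hp
  simp only [sub_mul, PiLp.sub_apply]
  rw [integral_sub i1 i2, integral_sub i3 i4, e1, e2]
  ring

theorem tendsto_eLpNorm_sub {F : Type*} [NormedAddCommGroup F] {μ : Measure Plane}
    {a b : ℕ → Plane → F} {A B : Plane → F}
    (ha : ∀ n, AEStronglyMeasurable (fun x => a n x - A x) μ)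
    (hb : ∀ n, AEStronglyMeasurable (fun x => b n x - B x) μ)
    (h : Tendsto (fun n => eLpNorm (fun x => a n x - A x) 2 μ) atTop (𝓝 0))
    (h' : Tendsto (fun n => eLpNorm (fun x => b n x - B x) 2 μ) atTop (𝓝 0)) :
    Tendsto (fun n => eLpNorm (fun x => (a n x - b n x) - (A x - B x)) 2 μ) atTop (𝓝 0) := by
  have hs := h.add h'
  rw [add_zero] at hs
  refine tendsto_of_tendsto_of_tendsto_of_le_of_le tendsto_const_nhds hs (fun _ => zero_le) ?_
  intro n
  have : (fun x => (a n x - b n x) - (A x - B x)) =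
      (fun x => a n x - A x) - (fun x => b n x - B x) := by
    funext x; simp only [Pi.sub_apply]; abel
  simp only [this]
  exact eLpNorm_sub_le (ha n) (hb n) (by norm_num)

theorem HasTrace.sub {U S : Set Plane} {w w' g g' : Plane → ℝ} {D D' : Plane → Plane}
    (h : HasTrace U S w D g) (h' : HasTrace U S w' D' g') :
    HasTrace U S (fun x => w x - w' x) (fun x => D x - D' x) (fun x => g x - g' x) := by
  obtain ⟨h1, h2, φ, hs, ha, hb, hc⟩ := h
  obtain ⟨h1', h2', φ', hs', ha', hb', hc'⟩ := h'
  have gc : ∀ {ψ : Plane → ℝ}, Smooth ψ → Continuous (gradient ψ) := fun {ψ} hψ =>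
    (InnerProductSpace.toDual ℝ Plane).symm.continuous.comp
      (ContDiff.continuous_fderiv hψ (by simp))
  refine ⟨h1.sub h1', h2.sub h2', fun n x => φ n x - φ' n x,
    fun n => ContDiff.sub (hs n) (hs' n), ?_, ?_, ?_⟩
  · exact tendsto_eLpNorm_sub
      (fun n => (ContDiff.continuous (hs n)).aestronglyMeasurable.sub h1.1.1)
      (fun n => (ContDiff.continuous (hs' n)).aestronglyMeasurable.sub h1'.1.1) ha ha'
  · have := tendsto_eLpNorm_sub
      (fun n => (gc (hs n)).aestronglyMeasurable.sub h1.2.1.1)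
      (fun n => (gc (hs' n)).aestronglyMeasurable.sub h1'.2.1.1) hb hb'
    have e : ∀ n x, gradient (fun y => φ n y - φ' n y) x =
        gradient (φ n) x - gradient (φ' n) x := by
      intro n x
      unfold gradient
      rw [fderiv_fun_sub ((ContDiff.differentiable (hs n) (by simp)) x)
        ((ContDiff.differentiable (hs' n) (by simp)) x), map_sub]
    simpa only [e] using this
  · exact tendsto_eLpNorm_sub
      (fun n => (ContDiff.continuous (hs n)).aestronglyMeasurable.sub h2.1)
      (fun n => (ContDiff.continuous (hs' n)).aestronglyMeasurable.sub h2'.1) hc hc'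

/-! ### The model problem -/

/-- A bounded domain with polygonal boundary, lying on one side of its boundary (no slits). -/
structure IsPolygonalDomain (Ω : Set Plane) : Prop where
  isOpen : IsOpen Ω
  isConnected : IsConnected Ω
  isBounded : Bornology.IsBounded Ω
  noSlit : interior (closure Ω) = Ω
  polygonal : ∃ s : Finset (Plane × Plane), frontier Ω = ⋃ p ∈ s, segment ℝ p.1 p.2

/-- `ΓD`, `ΓN` are disjoint relatively open parts of the boundary, of positive length, whose closures
cover the boundary. -/
structure IsBoundaryPartition (Ω ΓD ΓN : Set Plane) : Prop where
  openD : ∃ U, IsOpen U ∧ ΓD = frontier Ω ∩ U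
  openN : ∃ U, IsOpen U ∧ ΓN = frontier Ω ∩ U
  disjoint : Disjoint ΓD ΓN
  cover : closure ΓD ∪ closure ΓN = frontier Ω
  posD : (Measure.hausdorffMeasure 1 : Measure Plane) ΓD ≠ 0
  posN : (Measure.hausdorffMeasure 1 : Measure Plane) ΓN ≠ 0

/-- `κ ∈ L^∞(Ω)^{2×2}`, uniformly positive definite. -/
structure IsDiffusionTensor (Ω : Set Plane) (κ : Plane → Matrix (Fin 2) (Fin 2) ℝ) : Prop where
  bounded : ∀ i j, MemLp (fun x => κ x i j) ⊤ (area Ω)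
  posDef : ∃ α : ℝ, 0 < α ∧ ∀ᵐ x ∂(area Ω), ∀ ξ : Plane, α * ‖ξ‖ ^ 2 ≤ inner ℝ (mulV (κ x) ξ) ξ

/-- `τ` belongs to the space `H` of fields in `H(div; Ω)` with `τ · ν = 0` on `ΓN`; `d = div τ`.
The boundary condition is that the functional `w ↦ ⟨τ·ν, w⟩` vanishes on all `w ∈ H¹(Ω)` with zero
trace on `ΓD`. -/
def InH (Ω ΓD : Set Plane) (τ : Plane → Plane) (d : Plane → ℝ) : Prop :=
  HasDivL2 Ω τ d ∧
    ∀ w Dw, HasTrace Ω ΓD w Dw (fun _ => 0) →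
      ∫ x in Ω, (inner ℝ (τ x) (Dw x) + d x * w x) = 0

/-- `g ∈ H^{1/2}(ΓD)`: `g` is the trace on `ΓD` of a function in `H¹(Ω)`. -/
def InHHalf (Ω ΓD : Set Plane) (g : Plane → ℝ) : Prop :=
  ∃ w : (Plane → ℝ) × (Plane → Plane), HasTrace Ω ΓD w.1 w.2 g

open Classical in
/-- The duality pairing `⟨τ·ν, g⟩` over `ΓD` for `τ ∈ H` (with `d = div τ`) and `g ∈ H^{1/2}(ΓD)`:
the value `∫_Ω (τ·∇w + w div τ)` for any lifting `w ∈ H¹(Ω)` of `g`. -/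
def dirichletPairing (Ω ΓD : Set Plane) (τ : Plane → Plane) (d g : Plane → ℝ) : ℝ :=
  if h : InHHalf Ω ΓD g then
    ∫ x in Ω, (inner ℝ (τ x) (h.choose.2 x) + d x * h.choose.1 x)
  else 0

/-- The pairing does not depend on the lifting. -/
theorem dirichletPairing_eq {Ω ΓD : Set Plane} {τ : Plane → Plane} {d g w : Plane → ℝ}
    {Dw : Plane → Plane} (hτ : InH Ω ΓD τ d) (hw : HasTrace Ω ΓD w Dw g) :
    dirichletPairing Ω ΓD τ d g = ∫ x in Ω, (inner ℝ (τ x) (Dw x) + d x * w x) := by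
  have h : InHHalf Ω ΓD g := ⟨(w, Dw), hw⟩
  unfold dirichletPairing
  rw [dif_pos h]
  have hc := h.choose_spec
  set v := h.choose with hv
  have hz := hc.sub hw
  simp only [sub_self] at hz
  have key := hτ.2 _ _ hz
  have hI : ∀ {z : Plane → ℝ} {Dz : Plane → Plane}, HasGradL2 Ω z Dz →
      Integrable (fun x => inner ℝ (τ x) (Dz x) + d x * z x) (area Ω) := by
    intro z Dz hzD
    refine Integrable.add ?_ (hτ.1.2.1.integrable_mul hzD.1)
    have h0 := (MemLp.coord hτ.1.1 0).integrable_mul (MemLp.coord hzD.2.1 0)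
    have h1 := (MemLp.coord hτ.1.1 1).integrable_mul (MemLp.coord hzD.2.1 1)
    refine (h0.add h1).congr (ae_of_all _ fun x => ?_)
    simp [PiLp.inner_apply, Fin.sum_univ_two, mul_comm]
  have e : (fun x => inner ℝ (τ x) (v.2 x - Dw x) + d x * (v.1 x - w x)) =
      fun x => (inner ℝ (τ x) (v.2 x) + d x * v.1 x) - (inner ℝ (τ x) (Dw x) + d x * w x) := by
    funext x; rw [inner_sub_right]; ring
  rw [e, integral_sub (hI hc.1) (hI hw.1)] at key
  exact sub_eq_zero.mp key

/-- The local form `∫_U κ⁻¹ ζ · τ`. -/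
def aForm (κ : Plane → Matrix (Fin 2) (Fin 2) ℝ) (U : Set Plane) (ζ τ : Plane → Plane) : ℝ :=
  ∫ x in U, inner ℝ (mulV (κ x)⁻¹ (ζ x)) (τ x)

/-- `(σ, u) ∈ H × Q` solves the mixed variational formulation; `dσ = div σ`. -/
structure IsMixedSolution (Ω ΓD : Set Plane) (κ : Plane → Matrix (Fin 2) (Fin 2) ℝ)
    (f g : Plane → ℝ) (σ : Plane → Plane) (dσ u : Plane → ℝ) : Prop where
  flux_mem : InH Ω ΓD σ dσ
  scalar_mem : MemLp u 2 (area Ω)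
  first : ∀ τ d, InH Ω ΓD τ d →
    aForm κ Ω σ τ + ∫ x in Ω, u x * d x = dirichletPairing Ω ΓD τ d g
  second : ∀ v, MemLp v 2 (area Ω) → ∫ x in Ω, v x * dσ x = - ∫ x in Ω, f x * v x

/-! ### Polygonal meshes -/

/-- An open polygonal element: a bounded connected open set whose boundary is a simple closed
polygonal curve with `extra + 3` vertices (angles equal to `π` are allowed). Indices of vertices
are cyclic. -/
structure Polygon where
  extra : ℕ
  vertex : Fin (extra + 3) → Plane
  /-- the half-open edges are pairwise disjoint: the closed curve does not meet itself -/
  simple : Pairwise fun i j =>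
    Disjoint (AffineMap.lineMap (vertex i) (vertex (i + 1)) '' Set.Ico (0 : ℝ) 1)
      (AffineMap.lineMap (vertex j) (vertex (j + 1)) '' Set.Ico (0 : ℝ) 1)
  carrier : Set Plane
  isOpen : IsOpen carrier
  isConnected : IsConnected carrier
  isBounded : Bornology.IsBounded carrier
  frontier_eq : frontier carrier = ⋃ i, segment ℝ (vertex i) (vertex (i + 1))

namespace Polygon

variable (K : Polygon)

/-- The `i`-th (closed) edge. -/
def edge (i : Fin (K.extra + 3)) : Set Plane := segment ℝ (K.vertex i) (K.vertex (i + 1))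

/-- The `i`-th edge without its end points. -/
def openEdge (i : Fin (K.extra + 3)) : Set Plane :=
  openSegment ℝ (K.vertex i) (K.vertex (i + 1))

/-- The length `h_e` of the `i`-th edge. -/
def edgeLength (i : Fin (K.extra + 3)) : ℝ := dist (K.vertex i) (K.vertex (i + 1))

/-- The diameter `h_K`. -/
def diam : ℝ := Metric.diam K.carrier

/-- Shape regularity with constant `c`: each edge has length at least `c h_K`, and `K` is star-shaped
with respect to every point of a ball of radius `c h_K` with centre in `K`. -/
def IsRegular (c : ℝ) : Prop :=
  (∀ i, c * K.diam ≤ K.edgeLength i) ∧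
    ∃ xB ∈ K.carrier, ∀ y ∈ Metric.ball xB (c * K.diam), StarConvex ℝ y K.carrier

end Polygon

/-- A decomposition of `Ω` into finitely many non-overlapping open polygons. Every edge lies inside
`Ω`, on `ΓD` or on `ΓN`. -/
structure Mesh (Ω ΓD ΓN : Set Plane) where
  card : ℕ
  elem : Fin card → Polygon
  disjoint : Pairwise fun i j => Disjoint (elem i).carrier (elem j).carrier
  cover : closure Ω = ⋃ j, closure (elem j).carrier
  edge_mem : ∀ j i, (elem j).openEdge i ⊆ Ω ∨ (elem j).openEdge i ⊆ ΓD ∨ (elem j).openEdge i ⊆ ΓN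

/-- The mesh regularity assumption with constant `c`. -/
def Mesh.IsRegular {Ω ΓD ΓN : Set Plane} (T : Mesh Ω ΓD ΓN) (c : ℝ) : Prop :=
  ∀ j, (T.elem j).IsRegular c

/-! ### The mixed virtual element method of order `k` -/

/-- `p` is the `L²(K)`-orthogonal projection of `τ` onto `[P_k(K)]²`. -/
def IsL2Proj (k : ℕ) (K : Polygon) (τ : Plane → Plane) (p : VPoly2) : Prop :=
  VDegLT (k + 1) p ∧
    ∀ q, VDegLT (k + 1) q → ∫ x in K.carrier, inner ℝ (τ x - vev p x) (vev q x) = 0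

open Classical in
/-- The `L²(K)`-orthogonal projection of `τ ∈ L²(K)²` onto `[P_k(K)]²`. -/
def l2Proj (k : ℕ) (K : Polygon) (τ : Plane → Plane) : VPoly2 :=
  if h : ∃ p, IsL2Proj k K τ p then h.choose else 0

/-- The local virtual space `H_h^K`: `div τ ∈ P_k(K)`, `rot τ ∈ P_{k-1}(K)`, and the normal trace of
`τ` on `∂K`, understood through Green's formula, is a polynomial of degree `≤ k` on each edge. -/
def InVEMLocal (k : ℕ) (K : Polygon) (τ : Plane → Plane) : Prop :=
  ∃ d : Poly2, DegLT (k + 1) d ∧ HasDivL2 K.carrier τ (ev d) ∧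
    (∃ r : Poly2, DegLT k r ∧ HasRotL2 K.carrier τ (ev r)) ∧
    ∃ q : Fin (K.extra + 3) → Poly2, (∀ i, DegLT (k + 1) (q i)) ∧
      ∀ φ, Smooth φ →
        ∫ x in K.carrier, (inner ℝ (τ x) (gradient φ x) + ev d x * φ x) =
          ∑ i, ∫ x, ev (q i) x * φ x ∂(arc (K.edge i))

/-- The global virtual space `H_h`; `d = div τ`. -/
def InVEM {Ω ΓD ΓN : Set Plane} (k : ℕ) (T : Mesh Ω ΓD ΓN) (τ : Plane → Plane) (d : Plane → ℝ) :
    Prop :=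
  InH Ω ΓD τ d ∧ ∀ j, InVEMLocal k (T.elem j) τ

/-- `S` is an admissible stabilisation on `K`: a symmetric positive definite bilinear form on
`H_h^K`, equivalent to the local form on the kernel of the projection. -/
structure IsStabilisation (κ : Plane → Matrix (Fin 2) (Fin 2) ℝ) (k : ℕ) (K : Polygon) (c₀ c₁ : ℝ)
    (S : (Plane → Plane) → (Plane → Plane) → ℝ) : Prop where
  symm : ∀ ζ τ, InVEMLocal k K ζ → InVEMLocal k K τ → S ζ τ = S τ ζ
  add_left : ∀ ζ ζ' τ, InVEMLocal k K ζ → InVEMLocal k K ζ' → InVEMLocal k K τ →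
    S (fun x => ζ x + ζ' x) τ = S ζ τ + S ζ' τ
  smul_left : ∀ (c : ℝ) (ζ τ), InVEMLocal k K ζ → InVEMLocal k K τ →
    S (fun x => c • ζ x) τ = c * S ζ τ
  posDef : ∀ ζ, InVEMLocal k K ζ → ¬ (ζ =ᵐ[area K.carrier] fun _ => 0) → 0 < S ζ ζ
  lower : ∀ ζ, InVEMLocal k K ζ → l2Proj k K ζ = 0 → c₀ * aForm κ K.carrier ζ ζ ≤ S ζ ζ
  upper : ∀ ζ, InVEMLocal k K ζ → l2Proj k K ζ = 0 → S ζ ζ ≤ c₁ * aForm κ K.carrier ζ ζ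

/-- The local discrete form
`a_h^K(ζ, τ) = a^K(Πζ, Πτ) + S^K(ζ - Πζ, τ - Πτ)`. -/
def ahForm (κ : Plane → Matrix (Fin 2) (Fin 2) ℝ) (k : ℕ) (K : Polygon)
    (S : (Plane → Plane) → (Plane → Plane) → ℝ) (ζ τ : Plane → Plane) : ℝ :=
  aForm κ K.carrier (vev (l2Proj k K ζ)) (vev (l2Proj k K τ)) +
    S (fun x => ζ x - vev (l2Proj k K ζ) x) (fun x => τ x - vev (l2Proj k K τ) x)

/-- `(σ_h, u_h) ∈ H_h × Q_h` solves the virtual element scheme; `dh = div σ_h`. An element of the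
space `Q_h` of piecewise polynomials is given by its polynomial on each element. -/
structure IsVEMSolution {Ω ΓD ΓN : Set Plane} (κ : Plane → Matrix (Fin 2) (Fin 2) ℝ) (k : ℕ)
    (T : Mesh Ω ΓD ΓN) (S : Fin T.card → (Plane → Plane) → (Plane → Plane) → ℝ)
    (f g : Plane → ℝ) (σh : Plane → Plane) (dh : Plane → ℝ) (uh : Fin T.card → Poly2) : Prop where
  flux_mem : InVEM k T σh dh
  scalar_mem : ∀ j, DegLT (k + 1) (uh j)
  first : ∀ τ d, InVEM k T τ d →
    ∑ j, ahForm κ k (T.elem j) (S j) σh τ + ∑ j, ∫ x in (T.elem j).carrier, ev (uh j) x * d x =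
      dirichletPairing Ω ΓD τ d g
  second : ∀ v : Fin T.card → Poly2, (∀ j, DegLT (k + 1) (v j)) →
    ∑ j, ∫ x in (T.elem j).carrier, ev (v j) x * dh x =
      - ∑ j, ∫ x in (T.elem j).carrier, f x * ev (v j) x

/-- `s ∈ [P_{k+1}(K)]²` is the postprocessed flux on `K` computed from the projection of `σ_h` and
from `dh = div σ_h` by the local problem in the inner product of `H(div; K)`. -/
def IsPostprocessedFlux (k : ℕ) (K : Polygon) (σh : Plane → Plane) (dh : Plane → ℝ) (s : VPoly2) :
    Prop :=
  VDegLT (k + 2) s ∧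
    ∀ q, VDegLT (k + 2) q →
      (∫ x in K.carrier, inner ℝ (vev s x) (vev q x)) +
          ∫ x in K.carrier, ev (polyDiv s) x * ev (polyDiv q) x =
        (∫ x in K.carrier, inner ℝ (vev (l2Proj k K σh) x) (vev q x)) +
          ∫ x in K.carrier, dh x * ev (polyDiv q) x

/-- The right-hand side of the local efficiency estimates (without the constant):
`h_K² ‖σ - s‖² + h_K² ‖(κ⁻¹ - κ_h) s‖² + ‖u - u_h‖²`, with norms in `L²(K)`. -/
def localError (κ : Plane → Matrix (Fin 2) (Fin 2) ℝ) (K : Polygon) (σ : Plane → Plane)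
    (u : Plane → ℝ) (uh : Poly2) (s : VPoly2) (κh : Matrix (Fin 2) (Fin 2) Poly2) : ℝ :=
  K.diam ^ 2 * (∫ x in K.carrier, ‖σ x - vev s x‖ ^ 2) +
    K.diam ^ 2 * (∫ x in K.carrier, ‖mulV (κ x)⁻¹ (vev s x) - vev (polyMulV κh s) x‖ ^ 2) +
    ∫ x in K.carrier, (u x - ev uh x) ^ 2

end

end MixedVEM

open MixedVEM

/-!
The proof combines an interior estimate and a trace estimate on each element `K`. Both rest on the
mixed formulation for `(σ, u)`, tested with fields supported in `K`, on the shape regularity of `K`,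
and on the fact that `uh`, the postprocessed flux `s` and `κh` are polynomials of bounded degree on
`K`.

*Interior estimate.* Testing the mixed formulation with smooth fields of compact support shows that
`u` has the weak gradient `κ⁻¹ σ` (`IsMixedSolution.hasGradL2`). The residual `P = κh s - ∇uh` is a
polynomial field that differs from the weak gradient `κ⁻¹ σ - ∇uh` of `u - uh` by
`κ⁻¹ σ - κh s`, which the local error controls. As `K` contains a disc of radius comparable to
`h_K`, on that disc a cut-off function `χ` is available, and the test function `χ² P_i` gives the
bound for `P` after integration by parts (`exists_interior_estimate`). The inverse inequalities that
are needed follow by scaling from the equivalence of norms on polynomials of bounded degree over the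
unit disc (`exists_cutoff_bound`).

*Trace estimate.* For an edge `E` on `ΓD`, shape regularity provides an apex `a` in the disc whose
distance to the line of `E` is comparable to `h_K`; the triangle with apex `a` and base `E` lies in
`K`. On it consider the radial field `τ(x) = ψ(s(x)) (x - a)`, where `s(x)` is the radial projection
of `x` onto `E`, extended by zero. Since `τ` is tangential to the two lateral sides and `ψ(s(x))` is
constant along rays, `div τ = 2 ψ(s(x))`, and Green's formula
`∫ (τ·∇φ + φ div τ) = ℓ ∫_E ψ φ`, with `ℓ` the height of the triangle, reduces on each ray to the
fundamental theorem of calculus (`setIntegral_coneField_green`). It holds for every `ψ ∈ L²(E)`. So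
`τ` is an admissible test field (`coneField_inH`), and with `ψ = g - uh` the mixed formulation turns
into `ℓ ‖g - uh‖²_E = ∫ (τ·(κ⁻¹ σ - ∇uh) + (u - uh) div τ)`. Young's inequality bounds the right-hand
side by the interior quantities, and no local description of `Ω` near `E` is required
(`boundary_estimate`).
-/

namespace MixedVEM

/-! ### Coordinates and gradients -/

theorem gradient_apply (φ : Plane → ℝ) (x : Plane) (i : Fin 2) :
    gradient φ x i = fderiv ℝ φ x (EuclideanSpace.single i 1) := by
  rw [← inner_gradient_left, EuclideanSpace.inner_single_right]
  simp

theorem normSq_plane (v : Plane) : ‖v‖ ^ 2 = v 0 ^ 2 + v 1 ^ 2 := by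
  rw [EuclideanSpace.norm_sq_eq, Fin.sum_univ_two]; simp

theorem Smooth.continuous_gradient {φ : Plane → ℝ} (hφ : Smooth φ) : Continuous (gradient φ) :=
  (InnerProductSpace.toDual ℝ Plane).symm.continuous.comp
    (ContDiff.continuous_fderiv hφ (by simp))

theorem Smooth.differentiable {φ : Plane → ℝ} (hφ : Smooth φ) : Differentiable ℝ φ :=
  ContDiff.differentiable hφ (by simp)

theorem Smooth.mul {φ ψ : Plane → ℝ} (hφ : Smooth φ) (hψ : Smooth ψ) :
    Smooth (fun x => φ x * ψ x) := ContDiff.mul hφ hψ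

theorem gradient_mul {φ ψ : Plane → ℝ} (hφ : Smooth φ) (hψ : Smooth ψ) (x : Plane) (i : Fin 2) :
    gradient (fun y => φ y * ψ y) x i = gradient φ x i * ψ x + φ x * gradient ψ x i := by
  simp only [gradient_apply]
  rw [fderiv_fun_mul (hφ.differentiable x) (hψ.differentiable x)]
  simp; ring

/-! ### Polynomial functions -/

theorem hasFDerivAt_ev (p : Poly2) (x : Plane) :
    HasFDerivAt (ev p) (ev (MvPolynomial.pderiv 0 p) x • (EuclideanSpace.proj 0 : Plane →L[ℝ] ℝ) +
      ev (MvPolynomial.pderiv 1 p) x • (EuclideanSpace.proj 1 : Plane →L[ℝ] ℝ)) x := by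
  induction p using MvPolynomial.induction_on with
  | C a =>
    have e : ev (MvPolynomial.C a) = fun _ => a := by funext y; simp [ev]
    rw [e]
    simpa [ev] using hasFDerivAt_const (𝕜 := ℝ) (a : ℝ) x
  | add p q hp hq =>
    have := hp.add hq
    refine (this.congr_fderiv ?_).congr_of_eventuallyEq (Eventually.of_forall fun y => by simp [ev])
    ext v; simp [ev]; ring
  | mul_X p i hp =>
    have := hp.mul ((EuclideanSpace.proj i : Plane →L[ℝ] ℝ).hasFDerivAt (x := x))
    refine (this.congr_fderiv ?_).congr_of_eventuallyEq (Eventually.of_forall fun y => by simp [ev])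
    ext v
    fin_cases i <;> simp [ev, MvPolynomial.pderiv_X] <;> ring

theorem smooth_ev (p : Poly2) : Smooth (ev p) := by
  unfold Smooth
  induction p using MvPolynomial.induction_on with
  | C a =>
    have e : ev (MvPolynomial.C a) = fun _ => a := by funext y; simp [ev]
    rw [e]
    exact contDiff_const
  | add p q hp hq =>
    have e : ev (p + q) = fun y => ev p y + ev q y := by funext y; simp [ev]
    rw [e]
    exact ContDiff.add hp hq
  | mul_X p i hp =>
    have e : ev (p * MvPolynomial.X i) =
        fun y => ev p y * (EuclideanSpace.proj i : Plane →L[ℝ] ℝ) y := by funext y; simp [ev]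
    rw [e]
    exact ContDiff.mul hp (EuclideanSpace.proj i : Plane →L[ℝ] ℝ).contDiff

theorem gradient_ev (p : Poly2) (x : Plane) : gradient (ev p) x = vev (polyGrad p) x := by
  ext i
  rw [gradient_apply, (hasFDerivAt_ev p x).fderiv]
  fin_cases i <;> simp [vev, polyGrad]

theorem degLT_succ_iff {n : ℕ} {p : Poly2} : DegLT (n + 1) p ↔ p.totalDegree ≤ n := by
  rw [MvPolynomial.totalDegree, Finset.sup_le_iff]
  simp only [DegLT, Nat.lt_succ_iff]
  rfl

/-! ### Smooth functions are weakly differentiable -/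

theorem memLp_of_continuous {F : Type*} [NormedAddCommGroup F] {U : Set Plane}
    [SecondCountableTopology F]
    (hU : Bornology.IsBounded U) {f : Plane → F} (hf : Continuous f) : MemLp f 2 (area U) := by
  obtain ⟨r, hr⟩ := hU.subset_closedBall 0
  obtain ⟨C, hC⟩ := (isCompact_closedBall (0 : Plane) r).exists_bound_of_continuousOn hf.continuousOn
  have : IsFiniteMeasure (area (Metric.closedBall (0 : Plane) r)) :=
    isFiniteMeasure_restrict.mpr measure_closedBall_lt_top.ne
  have : MemLp f 2 (area (Metric.closedBall 0 r)) :=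
    MemLp.of_bound hf.aestronglyMeasurable C
      ((ae_restrict_iff' measurableSet_closedBall).mpr (ae_of_all _ hC))
  exact this.mono_measure (Measure.restrict_mono hr le_rfl)

theorem setIntegral_eq_of_isTest {U : Set Plane} {F : Type*} [NormedAddCommGroup F]
    [NormedSpace ℝ F] {φ : Plane → ℝ} (hφ : IsTest U φ) {f : Plane → F}
    (hf : ∀ x, x ∉ tsupport φ → f x = 0) : ∫ x in U, f x = ∫ x, f x :=
  setIntegral_eq_integral_of_forall_compl_eq_zero fun x hx => hf x fun h => hx (hφ.2.2 h)

theorem gradient_eq_zero_of_notMem_tsupport {φ : Plane → ℝ} {x : Plane} (hx : x ∉ tsupport φ) :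
    gradient φ x = 0 := by
  have : fderiv ℝ φ x = 0 := by
    by_contra h
    exact hx (support_fderiv_subset ℝ h)
  simp [gradient, this]

theorem Smooth.hasGradL2 {U : Set Plane} (hU : Bornology.IsBounded U) {w : Plane → ℝ}
    (hw : Smooth w) : HasGradL2 U w (gradient w) := by
  refine ⟨memLp_of_continuous hU (ContDiff.continuous hw),
    memLp_of_continuous hU hw.continuous_gradient, fun φ hφ i => ?_⟩
  have z : ∀ x, x ∉ tsupport φ → φ x = 0 := fun x hx => image_eq_zero_of_notMem_tsupport hx
  have cw : Continuous w := ContDiff.continuous hw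
  have cφ : Continuous φ := ContDiff.continuous hφ.1
  have cgw : Continuous fun x => gradient w x i :=
    (EuclideanSpace.proj i : Plane →L[ℝ] ℝ).continuous.comp hw.continuous_gradient
  have cgφ : Continuous fun x => gradient φ x i :=
    (EuclideanSpace.proj i : Plane →L[ℝ] ℝ).continuous.comp hφ.1.continuous_gradient
  have supp : ∀ {f : Plane → ℝ}, (∀ x, x ∉ tsupport φ → f x = 0) → HasCompactSupport f :=
    fun {f} hf => HasCompactSupport.intro hφ.2.1 fun x hx => hf x hx
  rw [setIntegral_eq_of_isTest hφ, setIntegral_eq_of_isTest hφ]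
  · have := integral_mul_fderiv_eq_neg_fderiv_mul_of_integrable (μ := (volume : Measure Plane))
      (f := w) (g := φ) (v := EuclideanSpace.single i 1) ?_ ?_ ?_
      (fun x _ => hw.differentiable x) (fun x _ => hφ.1.differentiable x)
    · simpa only [gradient_apply] using this
    · simp only [← gradient_apply]
      exact (cgw.mul cφ).integrable_of_hasCompactSupport (supp fun x hx => by simp [z x hx])
    · simp only [← gradient_apply]
      exact (cw.mul cgφ).integrable_of_hasCompactSupport
        (supp fun x hx => by simp [gradient_eq_zero_of_notMem_tsupport hx])
    · exact (cw.mul cφ).integrable_of_hasCompactSupport (supp fun x hx => by simp [z x hx])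
  · intro x hx; simp [z x hx]
  · intro x hx; simp [gradient_eq_zero_of_notMem_tsupport hx]

theorem IsTest.mono {U V : Set Plane} {φ : Plane → ℝ} (h : IsTest U φ) (hUV : U ⊆ V) :
    IsTest V φ := ⟨h.1, h.2.1, h.2.2.trans hUV⟩

theorem HasGradL2.mono {U V : Set Plane} {w : Plane → ℝ} {Dw : Plane → Plane}
    (h : HasGradL2 V w Dw) (hUV : U ⊆ V) : HasGradL2 U w Dw := by
  refine ⟨h.1.mono_measure (Measure.restrict_mono hUV le_rfl),
    h.2.1.mono_measure (Measure.restrict_mono hUV le_rfl), fun φ hφ i => ?_⟩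
  have z : ∀ x, x ∉ tsupport φ → φ x = 0 := fun x hx => image_eq_zero_of_notMem_tsupport hx
  have := h.2.2 φ (hφ.mono hUV) i
  rw [setIntegral_eq_of_isTest (hφ.mono hUV), setIntegral_eq_of_isTest (hφ.mono hUV)] at this
  · rwa [setIntegral_eq_of_isTest hφ, setIntegral_eq_of_isTest hφ]
    · intro x hx; simp [z x hx]
    · intro x hx; simp [gradient_eq_zero_of_notMem_tsupport hx]
  · intro x hx; simp [z x hx]
  · intro x hx; simp [gradient_eq_zero_of_notMem_tsupport hx]

/-! ### The diffusion tensor -/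

/-- Coercivity of `A` with constant `α` bounds `A⁻¹` by `α⁻¹`; in particular `A` is invertible and
`A⁻¹` is a true inverse. -/
theorem norm_mulV_inv_le {A : Matrix (Fin 2) (Fin 2) ℝ} {α : ℝ} (hα : 0 < α)
    (h : ∀ ξ : Plane, α * ‖ξ‖ ^ 2 ≤ inner ℝ (mulV A ξ) ξ) (ξ : Plane) :
    ‖mulV A⁻¹ ξ‖ ≤ α⁻¹ * ‖ξ‖ := by
  have hdet : IsUnit A.det := by
    rw [isUnit_iff_ne_zero]
    intro h0
    obtain ⟨v, hv, hAv⟩ := Matrix.exists_mulVec_eq_zero_iff.mpr h0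
    have := h (WithLp.toLp 2 v)
    simp only [mulV, hAv] at this
    have h2 : (0 : ℝ) < ‖(WithLp.toLp 2 v : Plane)‖ := by
      rw [norm_pos_iff]; simpa using hv
    have h3 : (WithLp.toLp 2 (0 : Fin 2 → ℝ) : Plane) = 0 := rfl
    rw [h3, inner_zero_left] at this
    have : 0 < α * ‖(WithLp.toLp 2 v : Plane)‖ ^ 2 := by positivity
    linarith
  set η := mulV A⁻¹ ξ with hη
  have hAη : mulV A η = ξ := by
    ext i
    change A.mulVec (A⁻¹.mulVec ξ.ofLp) i = ξ i
    rw [Matrix.mulVec_mulVec, Matrix.mul_nonsing_inv _ hdet, Matrix.one_mulVec]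
  have h1 := h η
  rw [hAη] at h1
  have h2 := real_inner_le_norm ξ η
  rcases (norm_nonneg η).eq_or_lt with h0 | h0
  · rw [← h0]; positivity
  · rw [inv_mul_eq_div, le_div_iff₀ hα]
    nlinarith

theorem mulV_sub (A : Matrix (Fin 2) (Fin 2) ℝ) (v w : Plane) :
    mulV A (v - w) = mulV A v - mulV A w := by
  simp only [mulV, WithLp.ofLp_sub, Matrix.mulVec_sub, WithLp.toLp_sub]

/-- Multiplication by `κ⁻¹` preserves `L²`. Measurability follows from the adjugate formula for the
inverse, the bound from coercivity. -/
theorem IsDiffusionTensor.memLp_mulV_inv {Ω : Set Plane} {κ : Plane → Matrix (Fin 2) (Fin 2) ℝ}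
    (hκ : IsDiffusionTensor Ω κ) {U : Set Plane} (hU : U ⊆ Ω) {τ : Plane → Plane}
    (hτ : MemLp τ 2 (area U)) : MemLp (fun x => mulV (κ x)⁻¹ (τ x)) 2 (area U) := by
  obtain ⟨α, hα, hpos⟩ := hκ.posDef
  have hκm : ∀ i j, AEStronglyMeasurable (fun x => κ x i j) (area U) := fun i j =>
    (hκ.bounded i j).1.mono_measure (Measure.restrict_mono hU le_rfl)
  have hdet : AEStronglyMeasurable (fun x => ((κ x).det)⁻¹) (area U) := by
    simp only [Matrix.det_fin_two]
    exact ((((hκm 0 0).mul (hκm 1 1)).sub ((hκm 0 1).mul (hκm 1 0))).aemeasurable.inv).aestronglyMeasurable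
  have hcoord : ∀ i, AEStronglyMeasurable (fun x => mulV (κ x)⁻¹ (τ x) i) (area U) := by
    intro i
    have t := fun j => (MemLp.coord hτ j).1
    fin_cases i
    · refine (hdet.mul (((hκm 1 1).mul (t 0)).sub ((hκm 0 1).mul (t 1)))).congr (ae_of_all _ fun x => ?_)
      simp [mulV, Matrix.inv_def, Matrix.adjugate_fin_two, Matrix.vecHead, Matrix.vecTail]
      ring
    · refine (hdet.mul (((hκm 0 0).mul (t 1)).sub ((hκm 1 0).mul (t 0)))).congr (ae_of_all _ fun x => ?_)
      simp [mulV, Matrix.inv_def, Matrix.adjugate_fin_two, Matrix.vecHead, Matrix.vecTail]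
      ring
  have hm : AEStronglyMeasurable (fun x => mulV (κ x)⁻¹ (τ x)) (area U) := by
    rw [aestronglyMeasurable_iff_aemeasurable]
    have h1 : AEMeasurable (fun x i => mulV (κ x)⁻¹ (τ x) i) (area U) :=
      aemeasurable_pi_lambda _ fun i => (hcoord i).aemeasurable
    exact (PiLp.continuous_toLp 2 (fun _ : Fin 2 => ℝ)).measurable.comp_aemeasurable h1
  refine hτ.of_le_mul (c := α⁻¹) hm ?_
  filter_upwards [ae_restrict_of_ae_restrict_of_subset hU hpos] with x hx
  exact norm_mulV_inv_le hα hx _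

/-! ### Polynomials: equivalence of norms and scaling -/

/-- On a finite-dimensional space, a positive definite continuous function homogeneous of degree two
dominates every other one, by compactness of the unit sphere. -/
theorem exists_le_mul_of_homogeneous {E : Type*} [NormedAddCommGroup E] [NormedSpace ℝ E]
    [FiniteDimensional ℝ E] {Q₁ Q₂ : E → ℝ} (h₁ : Continuous Q₁) (h₂ : Continuous Q₂)
    (s₁ : ∀ (t : ℝ) x, Q₁ (t • x) = t ^ 2 * Q₁ x) (s₂ : ∀ (t : ℝ) x, Q₂ (t • x) = t ^ 2 * Q₂ x)
    (pos : ∀ x, x ≠ 0 → 0 < Q₂ x) : ∃ C, 0 < C ∧ ∀ x, Q₁ x ≤ C * Q₂ x := by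
  have hK : IsCompact (Metric.sphere (0 : E) 1) := isCompact_sphere 0 1
  have hne : ∀ x ∈ Metric.sphere (0 : E) 1, x ≠ 0 := fun x hx h0 => by
    simp [h0] at hx
  obtain ⟨M, hM⟩ := hK.exists_bound_of_continuousOn (f := fun x => Q₁ x / Q₂ x)
    (h₁.continuousOn.div h₂.continuousOn fun x hx => (pos x (hne x hx)).ne')
  refine ⟨max M 1, by positivity, fun x => ?_⟩
  rcases eq_or_ne x 0 with rfl | hx
  · have e1 := s₁ 0 0
    have e2 := s₂ 0 0
    simp at e1 e2
    simp [e1, e2]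
  · have hn : ‖x‖ ≠ 0 := norm_ne_zero_iff.mpr hx
    set y := ‖x‖⁻¹ • x with hy
    have hys : y ∈ Metric.sphere (0 : E) 1 := by
      simp [hy, norm_smul, hn]
    have hxy : x = ‖x‖ • y := by rw [hy, smul_smul, mul_inv_cancel₀ hn, one_smul]
    have hp := pos y (hne y hys)
    have h1 : Q₁ y ≤ max M 1 * Q₂ y := by
      have := (le_abs_self _).trans (hM y hys)
      rw [div_le_iff₀ hp] at this
      exact this.trans (by gcongr; exact le_max_left _ _)
    rw [hxy, s₁, s₂]
    calc ‖x‖ ^ 2 * Q₁ y ≤ ‖x‖ ^ 2 * (max M 1 * Q₂ y) := by gcongr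
      _ = _ := by ring

/-- On a finite-dimensional space mapped linearly into `L²(μ)` in two ways, the second of them
injective, the first seminorm is bounded by a multiple of the second norm. -/
theorem exists_integral_sq_le {V : Type*} [AddCommGroup V] [Module ℝ V] [Module.Finite ℝ V]
    {X : Type*} [MeasurableSpace X] {μ : Measure X} (L₁ L₂ : V →ₗ[ℝ] (X → ℝ))
    (h₁ : ∀ v, MemLp (L₁ v) 2 μ) (h₂ : ∀ v, MemLp (L₂ v) 2 μ)
    (pos : ∀ v, v ≠ 0 → 0 < ∫ x, L₂ v x ^ 2 ∂μ) :
    ∃ C, 0 < C ∧ ∀ v, ∫ x, L₁ v x ^ 2 ∂μ ≤ C * ∫ x, L₂ v x ^ 2 ∂μ := by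
  have b := Module.finBasis ℝ V
  have cont : ∀ L : V →ₗ[ℝ] (X → ℝ), (∀ v, MemLp (L v) 2 μ) →
      Continuous fun c : Fin (Module.finrank ℝ V) → ℝ =>
        ∫ x, L (b.equivFun.symm c) x ^ 2 ∂μ := by
    intro L hL
    have e : (fun c : Fin (Module.finrank ℝ V) → ℝ => ∫ x, L (b.equivFun.symm c) x ^ 2 ∂μ) =
        fun c => ∑ i, ∑ j, (c i * c j) * ∫ x, L (b i) x * L (b j) x ∂μ := by
      funext c
      have : ∀ x, L (b.equivFun.symm c) x ^ 2 =
          ∑ i, ∑ j, (c i * c j) * (L (b i) x * L (b j) x) := by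
        intro x
        rw [Module.Basis.equivFun_symm_apply, map_sum, Finset.sum_apply, sq, Finset.sum_mul_sum]
        refine Finset.sum_congr rfl fun i _ => Finset.sum_congr rfl fun j _ => ?_
        simp; ring
      simp only [this]
      have I : ∀ i j, Integrable (fun x => (c i * c j) * (L (b i) x * L (b j) x)) μ :=
        fun i j => ((hL (b i)).integrable_mul (hL (b j))).const_mul _
      rw [integral_finsetSum _ fun i _ => integrable_finsetSum _ fun j _ => I i j]
      refine Finset.sum_congr rfl fun i _ => ?_
      rw [integral_finsetSum _ fun j _ => I i j]
      refine Finset.sum_congr rfl fun j _ => ?_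
      rw [integral_const_mul]
    rw [e]
    fun_prop
  have hom : ∀ L : V →ₗ[ℝ] (X → ℝ), ∀ (t : ℝ) (c : Fin (Module.finrank ℝ V) → ℝ),
      ∫ x, L (b.equivFun.symm (t • c)) x ^ 2 ∂μ =
        t ^ 2 * ∫ x, L (b.equivFun.symm c) x ^ 2 ∂μ := by
    intro L t c
    rw [← integral_const_mul]
    simp [mul_pow]
  obtain ⟨C, hC, h⟩ := exists_le_mul_of_homogeneous (cont L₁ h₁) (cont L₂ h₂) (hom L₁) (hom L₂)
    (fun c hc => pos _ ((b.equivFun.symm.map_ne_zero_iff).mpr hc))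
  refine ⟨C, hC, fun v => ?_⟩
  simpa using h (b.equivFun v)

theorem eq_zero_of_ev_eq_zero_on_ball {p : Poly2} {r : ℝ} (hr : 0 < r)
    (h : ∀ x ∈ Metric.ball (0 : Plane) r, ev p x = 0) : p = 0 := by
  refine MvPolynomial.funext_set (fun _ : Fin 2 => Set.Ioo (-(r / 2)) (r / 2))
    (fun _ => Set.Ioo_infinite (by linarith)) fun x hx => ?_
  have hm : (WithLp.toLp 2 x : Plane) ∈ Metric.ball (0 : Plane) r := by
    rw [mem_ball_zero_iff, ← abs_of_pos hr, ← abs_norm, ← sq_lt_sq, normSq_plane]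
    have h0 := hx 0 trivial
    have h1 := hx 1 trivial
    simp only [Set.mem_Ioo] at h0 h1
    simp only
    nlinarith [h0.1, h0.2, h1.1, h1.2]
  simpa [ev] using h _ hm

/-- The polynomial `y ↦ p (a + t y)`. -/
noncomputable def rescale (a : Plane) (t : ℝ) (p : Poly2) : Poly2 :=
  MvPolynomial.aeval (fun i => MvPolynomial.C (a i) + MvPolynomial.C t * MvPolynomial.X i) p

theorem ev_rescale (a : Plane) (t : ℝ) (p : Poly2) (y : Plane) :
    ev (rescale a t p) y = ev p (a + t • y) := by
  unfold ev rescale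
  rw [MvPolynomial.aeval_def, MvPolynomial.algebraMap_eq, MvPolynomial.eval_eval₂,
    MvPolynomial.eval, MvPolynomial.coe_eval₂Hom]
  congr 1
  · ext; simp
  · funext i; simp

theorem totalDegree_rescale_le (a : Plane) (t : ℝ) (p : Poly2) :
    (rescale a t p).totalDegree ≤ p.totalDegree := by
  unfold rescale
  rw [MvPolynomial.aeval_def, MvPolynomial.eval₂_eq']
  refine MvPolynomial.totalDegree_finsetSum_le fun α hα => ?_
  refine (MvPolynomial.totalDegree_mul _ _).trans ?_
  rw [MvPolynomial.algebraMap_eq, MvPolynomial.totalDegree_C, zero_add]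
  refine (MvPolynomial.totalDegree_finsetProd _ _).trans ?_
  have h1 : ∀ i, (MvPolynomial.C (a i) + MvPolynomial.C t * MvPolynomial.X i : Poly2).totalDegree
      ≤ 1 := fun i => by
    refine (MvPolynomial.totalDegree_add _ _).trans (max_le (by simp) ?_)
    refine (MvPolynomial.totalDegree_mul _ _).trans ?_
    simp
  have h2 := MvPolynomial.le_totalDegree hα
  rw [Finsupp.sum_fintype _ _ (fun _ => rfl)] at h2
  refine (Finset.sum_le_sum fun i _ => ?_).trans h2
  exact (MvPolynomial.totalDegree_pow _ _).trans
    ((Nat.mul_le_mul_left _ (h1 i)).trans (by simp))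

/-- Equivalence of norms on polynomials of bounded degree over the unit disc, with a cut-off
function as weight. The weighted norm is a norm because a polynomial vanishing on a disc is zero. -/
theorem exists_cutoff_bound (N : ℕ) {r : ℝ} (hr : 0 < r) (hr1 : r < 1) {χ : Plane → ℝ}
    (hχ : Smooth χ) (hone : ∀ x ∈ Metric.ball (0 : Plane) r, χ x = 1) :
    ∃ C, 0 < C ∧ ∀ p : Poly2, p.totalDegree ≤ N →
      (∫ x in Metric.closedBall 0 1, ev p x ^ 2 ≤
        C * ∫ x in Metric.closedBall 0 1, (χ x * ev p x) ^ 2) ∧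
      ∀ i, ∫ x in Metric.closedBall 0 1, (gradient (fun y => χ y ^ 2 * ev p y) x i) ^ 2 ≤
        C * ∫ x in Metric.closedBall 0 1, (χ x * ev p x) ^ 2 := by
  set V := MvPolynomial.restrictTotalDegree (Fin 2) ℝ N with hV
  have hχ2 : Smooth fun x => χ x ^ 2 := ContDiff.pow hχ 2
  have hB : Bornology.IsBounded (Metric.closedBall (0 : Plane) 1) := Metric.isBounded_closedBall
  let L : V →ₗ[ℝ] (Plane → ℝ) :=
    { toFun := fun p x => ev p x
      map_add' := fun p q => by funext x; simp [ev]
      map_smul' := fun c p => by funext x; simp [ev] }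
  let Lχ : V →ₗ[ℝ] (Plane → ℝ) :=
    { toFun := fun p x => χ x * ev p x
      map_add' := fun p q => by funext x; simp [ev]; ring
      map_smul' := fun c p => by funext x; simp [ev]; ring }
  let LD : Fin 2 → V →ₗ[ℝ] (Plane → ℝ) := fun i =>
    { toFun := fun p x => gradient (fun y => χ y ^ 2 * ev p y) x i
      map_add' := fun p q => by
        funext x
        simp only [Pi.add_apply, gradient_mul hχ2 (smooth_ev _), gradient_ev]
        simp [ev, vev, polyGrad]; ring
      map_smul' := fun c p => by
        funext x
        simp only [Pi.smul_apply, gradient_mul hχ2 (smooth_ev _), gradient_ev]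
        simp [ev, vev, polyGrad]; ring }
  have cL : ∀ v, MemLp (L v) 2 (area (Metric.closedBall 0 1)) := fun v =>
    memLp_of_continuous hB (ContDiff.continuous (smooth_ev _))
  have hcont : ∀ v, Continuous (Lχ v) := fun v =>
    ContDiff.continuous (hχ.mul (smooth_ev _))
  have cLχ : ∀ v, MemLp (Lχ v) 2 (area (Metric.closedBall 0 1)) := fun v =>
    memLp_of_continuous hB (hcont v)
  have cLD : ∀ i v, MemLp (LD i v) 2 (area (Metric.closedBall 0 1)) := fun i v =>
    memLp_of_continuous hB ((EuclideanSpace.proj i : Plane →L[ℝ] ℝ).continuous.comp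
      (hχ2.mul (smooth_ev _)).continuous_gradient)
  have pos : ∀ v, v ≠ 0 → 0 < ∫ x in Metric.closedBall 0 1, Lχ v x ^ 2 := by
    intro v hv
    obtain ⟨x, hx, hvx⟩ : ∃ x ∈ Metric.ball (0 : Plane) r, ev v x ≠ 0 := by
      by_contra! h
      exact hv (Subtype.ext (eq_zero_of_ev_eq_zero_on_ball hr h))
    have hle : ∫ x in Metric.ball 0 1, Lχ v x ^ 2 ≤ ∫ x in Metric.closedBall 0 1, Lχ v x ^ 2 :=
      setIntegral_mono_set (cLχ v).integrable_sq (ae_of_all _ fun x => sq_nonneg _)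
        (LE.le.eventuallyLE Metric.ball_subset_closedBall)
    refine lt_of_lt_of_le ?_ hle
    rw [setIntegral_pos_iff_support_of_nonneg_ae (ae_of_all _ fun x => sq_nonneg _)
      ((cLχ v).integrable_sq.mono_measure
        (Measure.restrict_mono Metric.ball_subset_closedBall le_rfl))]
    refine IsOpen.measure_pos _ (((hcont v).pow 2).isOpen_support.inter Metric.isOpen_ball) ?_
    refine ⟨x, ?_, Metric.ball_subset_ball hr1.le hx⟩
    simpa [Lχ, hone x hx] using hvx
  obtain ⟨C, hC, h⟩ := exists_integral_sq_le L Lχ cL cLχ pos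
  choose D hD hh using fun i => exists_integral_sq_le (LD i) Lχ (cLD i) cLχ pos
  refine ⟨C + D 0 + D 1, by have := hD 0; have := hD 1; positivity, fun p hp => ?_⟩
  have hpV : p ∈ V := (MvPolynomial.mem_restrictTotalDegree _ _ _).mpr hp
  have hI : 0 ≤ ∫ x in Metric.closedBall 0 1, (χ x * ev p x) ^ 2 :=
    integral_nonneg fun x => sq_nonneg _
  have h0 := hD 0
  have h1 := hD 1
  refine ⟨(h ⟨p, hpV⟩).trans ?_, fun i => (hh i ⟨p, hpV⟩).trans ?_⟩
  · exact mul_le_mul_of_nonneg_right (by linarith) hI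
  · refine mul_le_mul_of_nonneg_right ?_ hI
    fin_cases i <;> simp <;> linarith

theorem setIntegral_rescale (a : Plane) {h : ℝ} (hh : 0 < h) (F : Plane → ℝ) :
    ∫ x in Metric.closedBall a h, F (h⁻¹ • (x - a)) =
      h ^ 2 * ∫ x in Metric.closedBall 0 1, F x := by
  rw [← integral_indicator measurableSet_closedBall, ← integral_indicator measurableSet_closedBall]
  have e : (Metric.closedBall a h).indicator (fun x => F (h⁻¹ • (x - a))) =
      fun x => ((Metric.closedBall (0 : Plane) 1).indicator F) (h⁻¹ • (x - a)) := by
    funext x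
    have : x ∈ Metric.closedBall a h ↔ h⁻¹ • (x - a) ∈ Metric.closedBall (0 : Plane) 1 := by
      rw [mem_closedBall_iff_norm, mem_closedBall_zero_iff, norm_smul, norm_inv,
        Real.norm_of_nonneg hh.le, inv_mul_le_iff₀ hh, mul_one]
    by_cases hx : x ∈ Metric.closedBall a h
    · rw [Set.indicator_of_mem hx, Set.indicator_of_mem (this.mp hx)]
    · rw [Set.indicator_of_notMem hx, Set.indicator_of_notMem (this.not.mp hx)]
  rw [e, integral_sub_right_eq_self
      (fun x => ((Metric.closedBall (0 : Plane) 1).indicator F) (h⁻¹ • x)) a,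
    Measure.integral_comp_inv_smul_of_nonneg _ _ hh.le]
  simp

theorem gradient_rescale {φ : Plane → ℝ} (hφ : Smooth φ) (a : Plane) (t : ℝ) (x : Plane)
    (i : Fin 2) :
    gradient (fun y => φ (t • (y - a))) x i = t * gradient φ (t • (x - a)) i := by
  rw [gradient_apply, gradient_apply]
  have h1 : HasFDerivAt (fun y : Plane => t • (y - a)) (t • ContinuousLinearMap.id ℝ Plane) x :=
    ((hasFDerivAt_id x).sub_const a).const_smul t
  have h2 := (hφ.differentiable (t • (x - a))).hasFDerivAt.comp x h1
  have h3 : fderiv ℝ (fun y => φ (t • (y - a))) x = _ := h2.fderiv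
  rw [h3]
  simp

/-- Young's inequality in `L²`. -/
theorem integral_mul_le_young {X : Type*} [MeasurableSpace X] {μ : Measure X} {f g : X → ℝ}
    (hf : MemLp f 2 μ) (hg : MemLp g 2 μ) {δ : ℝ} (hδ : 0 < δ) :
    ∫ x, f x * g x ∂μ ≤ δ * (∫ x, f x ^ 2 ∂μ) + (4 * δ)⁻¹ * ∫ x, g x ^ 2 ∂μ := by
  rw [← integral_const_mul, ← integral_const_mul,
    ← integral_add (hf.integrable_sq.const_mul _) (hg.integrable_sq.const_mul _)]
  refine integral_mono (hf.integrable_mul hg) ((hf.integrable_sq.const_mul _).add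
    (hg.integrable_sq.const_mul _)) fun x => ?_
  have e : δ * f x ^ 2 + (4 * δ)⁻¹ * g x ^ 2 - f x * g x = δ * (f x - (2 * δ)⁻¹ * g x) ^ 2 := by
    field_simp; ring
  have : 0 ≤ δ * (f x - (2 * δ)⁻¹ * g x) ^ 2 := by positivity
  beta_reduce
  linarith

/-- If the polynomial `p` approximates the `i`-th weak derivative of `v` on `U`, it is controlled by
the error and by `v` itself; `U` contains a disc of radius comparable to its size `h`. The test
function is `χ² p`, with `χ` a cut-off function on the disc. -/
theorem exists_interior_estimate (N : ℕ) {c : ℝ} (hc : 0 < c) : ∃ C, 0 < C ∧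
    ∀ (a : Plane) (h : ℝ), 0 < h → ∀ U : Set Plane, IsOpen U → Metric.ball a (c * h) ⊆ U →
      U ⊆ Metric.closedBall a h → ∀ (v : Plane → ℝ) (Dv : Plane → Plane), HasGradL2 U v Dv →
      ∀ p : Poly2, p.totalDegree ≤ N → ∀ i,
        h ^ 2 * ∫ x in U, ev p x ^ 2 ≤
          C * (h ^ 2 * (∫ x in U, (ev p x - Dv x i) ^ 2) + ∫ x in U, v x ^ 2) := by
  set r := min (c / 4) (1 / 2) with hr
  have hr0 : 0 < r := by positivity
  have hrc : r ≤ c / 4 := min_le_left _ _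
  let b : ContDiffBump (0 : Plane) := ⟨r, 2 * r, hr0, by linarith⟩
  have hχ : Smooth b := b.contDiff
  obtain ⟨C, hC, href⟩ := exists_cutoff_bound N hr0 (by linarith [min_le_right (c / 4) (1 / 2)])
    hχ (fun x hx => b.one_of_mem_closedBall (Metric.ball_subset_closedBall hx))
  refine ⟨2 * C + 2 * C ^ 2, by positivity, fun a h hh U hU hball hUb v Dv hv p hp i => ?_⟩
  set q := rescale a h p with hq
  obtain ⟨r1, r2⟩ := href q ((totalDegree_rescale_le a h p).trans hp)
  have hUbd : Bornology.IsBounded U := Metric.isBounded_closedBall.subset hUb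
  have hs : Smooth fun x => b (h⁻¹ • (x - a)) := by
    refine ContDiff.comp (g := b) hχ ?_
    fun_prop
  set χ : Plane → ℝ := fun x => b (h⁻¹ • (x - a)) with hχdef
  have hev : ∀ x, ev q (h⁻¹ • (x - a)) = ev p x := fun x => by
    rw [hq, ev_rescale, smul_smul, mul_inv_cancel₀ hh.ne', one_smul]; congr 1; abel
  have sχ2 : Smooth fun x => χ x ^ 2 := ContDiff.pow hs 2
  set φ : Plane → ℝ := fun x => χ x ^ 2 * ev p x with hφdef
  have sφ : Smooth φ := sχ2.mul (smooth_ev p)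
  have hχ0 : ∀ x, 0 ≤ χ x := fun x => b.nonneg
  have hχ1 : ∀ x, χ x ≤ 1 := fun x => b.le_one
  have hχsupp : ∀ x, x ∉ Metric.closedBall a (c * h / 2) → χ x = 0 := by
    intro x hx
    refine b.zero_of_le_dist ?_
    rw [mem_closedBall_iff_norm, not_le] at hx
    rw [dist_zero_right, norm_smul, norm_inv, Real.norm_of_nonneg hh.le]
    change 2 * r ≤ _
    rw [le_inv_mul_iff₀ hh]
    nlinarith
  have hcl : Metric.closedBall a (c * h / 2) ⊆ U :=
    (Metric.closedBall_subset_ball (by nlinarith [mul_pos hc hh])).trans hball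
  have hφts : tsupport φ ⊆ Metric.closedBall a (c * h / 2) := by
    refine closure_minimal (fun x hx => ?_) Metric.isClosed_closedBall
    by_contra hx'
    exact hx (by simp [hφdef, hχsupp x hx'])
  have hφ : IsTest U φ := ⟨sφ, (isCompact_closedBall _ _).of_isClosed_subset
    (isClosed_tsupport _) hφts, hφts.trans hcl⟩
  -- the inequalities on the unit disc, transported to the disc of radius `h`
  set A := ∫ x in U, (χ x * ev p x) ^ 2 with hA
  have hAball : ∫ x in Metric.closedBall a h, (χ x * ev p x) ^ 2 = A := by
    refine setIntegral_eq_of_subset_of_forall_sdiff_eq_zero measurableSet_closedBall hUb ?_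
    intro x hx
    simp [hχsupp x fun hx' => hx.2 (hcl hx')]
  have hA' : h ^ 2 * ∫ x in Metric.closedBall 0 1, (b x * ev q x) ^ 2 = A := by
    rw [← hAball, ← setIntegral_rescale a hh (fun y => (b y * ev q y) ^ 2)]
    simp only [hev, hχdef]
  have s1 : ∫ x in U, ev p x ^ 2 ≤ C * A := by
    have e := setIntegral_rescale a hh (fun y => ev q y ^ 2)
    simp only [hev] at e
    calc ∫ x in U, ev p x ^ 2 ≤ ∫ x in Metric.closedBall a h, ev p x ^ 2 :=
          setIntegral_mono_set
            (memLp_of_continuous Metric.isBounded_closedBall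
              (ContDiff.continuous (smooth_ev p))).integrable_sq
            (ae_of_all _ fun x => sq_nonneg _) (LE.le.eventuallyLE hUb)
      _ = h ^ 2 * ∫ x in Metric.closedBall 0 1, ev q x ^ 2 := e
      _ ≤ h ^ 2 * (C * ∫ x in Metric.closedBall 0 1, (b x * ev q x) ^ 2) := by gcongr
      _ = C * A := by rw [← hA']; ring
  have s2 : h ^ 2 * ∫ x in U, gradient φ x i ^ 2 ≤ C * A := by
    have e := setIntegral_rescale a hh
      (fun z => gradient (fun y => b y ^ 2 * ev q y) z i ^ 2)
    have hφe : φ = fun y => (fun y => b y ^ 2 * ev q y) (h⁻¹ • (y - a)) := by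
      funext y; simp only [hφdef, hχdef, hev]
    have hg : ∀ x, gradient (fun y => b y ^ 2 * ev q y) (h⁻¹ • (x - a)) i =
        h * gradient φ x i := fun x => by
      rw [hφe, gradient_rescale ((show Smooth fun y => b y ^ 2 from ContDiff.pow hχ 2).mul
        (smooth_ev q)), ← mul_assoc, mul_inv_cancel₀ hh.ne', one_mul]
    simp only [hg, mul_pow] at e
    rw [integral_const_mul] at e
    have e' := mul_left_cancel₀ (by positivity) e
    calc h ^ 2 * ∫ x in U, gradient φ x i ^ 2
        ≤ h ^ 2 * ∫ x in Metric.closedBall a h, gradient φ x i ^ 2 := by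
          gcongr ?_ * ?_
          exact setIntegral_mono_set
            (memLp_of_continuous Metric.isBounded_closedBall
              ((EuclideanSpace.proj i : Plane →L[ℝ] ℝ).continuous.comp
                sφ.continuous_gradient)).integrable_sq
            (ae_of_all _ fun x => sq_nonneg _) (LE.le.eventuallyLE hUb)
      _ = h ^ 2 * ∫ x in Metric.closedBall 0 1, gradient (fun y => b y ^ 2 * ev q y) x i ^ 2 := by
          rw [e']
      _ ≤ h ^ 2 * (C * ∫ x in Metric.closedBall 0 1, (b x * ev q x) ^ 2) := by
          gcongr; exact r2 i
      _ = C * A := by rw [← hA']; ring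
  -- the definition of the weak derivative with test function `χ² p`; the factor `χ²` leaves `χ p`
  -- for each of the two norms in the estimate
  have mp : MemLp (ev p) 2 (area U) := memLp_of_continuous hUbd (ContDiff.continuous (smooth_ev p))
  have mφ : MemLp φ 2 (area U) := memLp_of_continuous hUbd (ContDiff.continuous sφ)
  have mg : MemLp (fun x => gradient φ x i) 2 (area U) :=
    MemLp.coord (memLp_of_continuous hUbd sφ.continuous_gradient) i
  have mχp : MemLp (fun x => χ x * ev p x) 2 (area U) :=
    memLp_of_continuous hUbd (ContDiff.continuous (hs.mul (smooth_ev p)))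
  have mD := MemLp.coord hv.2.1 i
  have mR : MemLp (fun x => ev p x - Dv x i) 2 (area U) := mp.sub mD
  set X := ∫ x in U, (ev p x - Dv x i) ^ 2 with hX
  set Y := ∫ x in U, v x ^ 2 with hY
  have key : A = (∫ x in U, (ev p x - Dv x i) * φ x) + ∫ x in U, v x * -gradient φ x i := by
    have e1 := hv.2.2 φ hφ i
    have i1 : Integrable (fun x => (ev p x - Dv x i) * φ x) (area U) := mR.integrable_mul mφ
    have i3 : Integrable (fun x => Dv x i * φ x) (area U) := mD.integrable_mul mφ
    simp only [mul_neg]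
    rw [integral_neg, e1, neg_neg, ← integral_add i1 i3, hA]
    refine integral_congr_ae (ae_of_all _ fun x => ?_)
    simp only [hφdef]; ring
  have hφA : ∫ x in U, φ x ^ 2 ≤ A := by
    refine integral_mono mφ.integrable_sq mχp.integrable_sq fun x => ?_
    have : φ x ^ 2 = χ x ^ 2 * (χ x * ev p x) ^ 2 := by simp only [hφdef]; ring
    simp only [this]
    exact mul_le_of_le_one_left (sq_nonneg _) (pow_le_one₀ (hχ0 x) (hχ1 x))
  have y1 := integral_mul_le_young mR mφ one_pos
  have y2 := integral_mul_le_young hv.1 mg.neg (δ := C * (h ^ 2)⁻¹) (by positivity)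
  simp only [Pi.neg_apply, neg_sq] at y2
  have hY0 : 0 ≤ Y := integral_nonneg fun x => sq_nonneg _
  have hX0 : 0 ≤ X := integral_nonneg fun x => sq_nonneg _
  have hg4 : (4 * (C * (h ^ 2)⁻¹))⁻¹ * ∫ x in U, gradient φ x i ^ 2 ≤ (1 / 4) * A := by
    calc (4 * (C * (h ^ 2)⁻¹))⁻¹ * ∫ x in U, gradient φ x i ^ 2
        = (4 * C)⁻¹ * (h ^ 2 * ∫ x in U, gradient φ x i ^ 2) := by field_simp
      _ ≤ (4 * C)⁻¹ * (C * A) := by gcongr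
      _ = (1 / 4) * A := by field_simp
  have hA2 : A ≤ 2 * X + 2 * (C * (h ^ 2)⁻¹ * Y) := by linarith
  calc h ^ 2 * ∫ x in U, ev p x ^ 2 ≤ h ^ 2 * (C * (2 * X + 2 * (C * (h ^ 2)⁻¹ * Y))) := by
        gcongr; exact s1.trans (by gcongr)
    _ = 2 * C * (h ^ 2 * X) + 2 * C ^ 2 * Y := by field_simp
    _ ≤ (2 * C + 2 * C ^ 2) * (h ^ 2 * X + Y) := by
        have : 0 ≤ h ^ 2 * X := by positivity
        nlinarith [mul_nonneg hC.le hY0, mul_nonneg (sq_nonneg C) this]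

/-! ### The weak gradient of the scalar unknown -/

theorem inner_single_left (i : Fin 2) (t : ℝ) (v : Plane) :
    inner ℝ (EuclideanSpace.single i t : Plane) v = t * v i := by
  rw [EuclideanSpace.inner_single_left]; simp

/-- Fields with compact support in `Ω` have zero normal trace. -/
theorem IsTest.integral_pairing_eq_zero {Ω : Set Plane} (hb : Bornology.IsBounded Ω)
    {φ : Plane → ℝ} (hφ : IsTest Ω φ) (i : Fin 2) {w : Plane → ℝ} {Dw : Plane → Plane}
    (hw : HasGradL2 Ω w Dw) :
    ∫ x in Ω, (inner ℝ (EuclideanSpace.single i (φ x) : Plane) (Dw x) +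
      gradient φ x i * w x) = 0 := by
  have hg := hφ.1.hasGradL2 hb
  have i1 : Integrable (fun x => φ x * Dw x i) (area Ω) :=
    hg.1.integrable_mul (MemLp.coord hw.2.1 i)
  have i2 : Integrable (fun x => gradient φ x i * w x) (area Ω) :=
    (MemLp.coord hg.2.1 i).integrable_mul hw.1
  simp only [inner_single_left]
  rw [integral_add i1 i2]
  simp only [mul_comm (gradient φ _ i), mul_comm (φ _)]
  rw [hw.2.2 φ hφ i]; ring

theorem IsTest.inH {Ω ΓD : Set Plane} (hb : Bornology.IsBounded Ω) {φ : Plane → ℝ}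
    (hφ : IsTest Ω φ) (i : Fin 2) :
    InH Ω ΓD (fun x => EuclideanSpace.single i (φ x)) (fun x => gradient φ x i) := by
  have hg := hφ.1.hasGradL2 hb
  have hc : Continuous fun x => (EuclideanSpace.single i (φ x) : Plane) := by
    have : ∀ x, (EuclideanSpace.single i (φ x) : Plane) =
        φ x • (EuclideanSpace.single i 1 : Plane) := fun x => by
      ext j; by_cases h : j = i <;> simp [h]
    simp only [this]
    exact (ContDiff.continuous hφ.1).smul continuous_const
  refine ⟨⟨memLp_of_continuous hb hc, MemLp.coord hg.2.1 i, fun ψ hψ => ?_⟩, fun w Dw hw => ?_⟩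
  · simp only [inner_single_left]
    exact hg.2.2 ψ hψ i
  · exact hφ.integral_pairing_eq_zero hb i hw.1

/-- The first equation of the mixed formulation says that `u` is weakly differentiable with
`∇u = κ⁻¹ σ`. -/
theorem IsMixedSolution.hasGradL2 {Ω ΓD : Set Plane} (hb : Bornology.IsBounded Ω)
    {κ : Plane → Matrix (Fin 2) (Fin 2) ℝ} (hκ : IsDiffusionTensor Ω κ) {f g : Plane → ℝ}
    (hg : InHHalf Ω ΓD g) {σ : Plane → Plane} {dσ u : Plane → ℝ}
    (h : IsMixedSolution Ω ΓD κ f g σ dσ u) :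
    HasGradL2 Ω u (fun x => mulV (κ x)⁻¹ (σ x)) := by
  refine ⟨h.scalar_mem, hκ.memLp_mulV_inv subset_rfl h.flux_mem.1.1, fun φ hφ i => ?_⟩
  obtain ⟨⟨w, Dw⟩, hw⟩ := hg
  have hH := hφ.inH (ΓD := ΓD) hb i
  have e := h.first _ _ hH
  rw [dirichletPairing_eq hH hw, hφ.integral_pairing_eq_zero hb i hw.1, aForm] at e
  simp only [real_inner_comm (EuclideanSpace.single i _ : Plane), inner_single_left] at e
  simp only [mul_comm (φ _)] at e
  linarith

/-! ### Triangles in radial coordinates -/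

/-- The cross product of two plane vectors. For a unit vector `e` the height of the triangle with apex
`a` over the line through `v` in direction `e` is `|cross (v - a) e|`. -/
def cross (x y : Plane) : ℝ := x 0 * y 1 - x 1 * y 0

/-- Expansion of a vector in the basis `w`, `e`. -/
theorem cross_expand {w e : Plane} (h : cross w e ≠ 0) (y : Plane) :
    y = (cross y e / cross w e) • w + (cross w y / cross w e) • e := by
  ext i
  have key : ∀ i, y i * cross w e = cross y e * w i + cross w y * e i := by
    intro i; fin_cases i <;> simp [cross] <;> ring
  have := eq_div_of_mul_eq h (key i)
  simp only [PiLp.add_apply, PiLp.smul_apply, smul_eq_mul]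
  rw [this]; ring

theorem cross_comb_left (w e : Plane) (s t : ℝ) :
    cross (s • w + t • e) e = s * cross w e := by simp [cross]; ring

theorem cross_comb_right (w e : Plane) (s t : ℝ) :
    cross w (s • w + t • e) = t * cross w e := by simp [cross]; ring

theorem continuous_coord (i : Fin 2) : Continuous fun x : Plane => x i :=
  (EuclideanSpace.proj i : Plane →L[ℝ] ℝ).continuous

theorem continuous_cross {X : Type*} [TopologicalSpace X] {f g : X → Plane} (hf : Continuous f)
    (hg : Continuous g) : Continuous fun x => cross (f x) (g x) := by
  have c := continuous_coord
  unfold cross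
  exact (((c 0).comp hf).mul ((c 1).comp hg)).sub (((c 1).comp hf).mul ((c 0).comp hg))

/-- The point at fraction `z 0` on the segment from `a` to the point of parameter `z 1` on the line
through `v` in direction `e`. -/
noncomputable def cone (a v e z : Plane) : Plane := a + z 0 • (v + z 1 • e - a)

/-- The radial coordinate of `x`, inverse to `cone`. -/
noncomputable def coneRad (a v e x : Plane) : ℝ := cross (x - a) e / cross (v - a) e

/-- The radial projection of `x` from `a` to the line through `v` in direction `e`, as a parameter on
that line. It is meaningful only where `coneRad` does not vanish, as on `coneSet`. -/
noncomputable def coneProj (a v e x : Plane) : ℝ :=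
  cross (v - a) (x - a) / cross (v - a) e / coneRad a v e x

/-- The parameter domain of the triangle. -/
def coneDom (L : ℝ) : Set Plane := {z | z 0 ∈ Set.Ioo (0 : ℝ) 1 ∧ z 1 ∈ Set.Ioo 0 L}

/-- The open triangle with apex `a` whose base starts at `v` and has direction `e`, length `L`. -/
def coneSet (a v e : Plane) (L : ℝ) : Set Plane :=
  {x | coneRad a v e x ∈ Set.Ioo (0 : ℝ) 1 ∧ coneProj a v e x ∈ Set.Ioo 0 L}

section Cone

variable {a v e : Plane} (h : cross (v - a) e ≠ 0)
include h

theorem coneRad_cone (z : Plane) : coneRad a v e (cone a v e z) = z 0 := by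
  have : cone a v e z - a = z 0 • (v - a) + (z 0 * z 1) • e := by
    unfold cone; module
  rw [coneRad, this, cross_comb_left, mul_div_cancel_right₀ _ h]

theorem coneProj_cone {z : Plane} (hz : z 0 ≠ 0) : coneProj a v e (cone a v e z) = z 1 := by
  have : cone a v e z - a = z 0 • (v - a) + (z 0 * z 1) • e := by
    unfold cone; module
  rw [coneProj, coneRad_cone h, this, cross_comb_right, mul_div_cancel_right₀ _ h,
    mul_div_cancel_left₀ _ hz]

theorem cone_coord {x : Plane} (hx : coneRad a v e x ≠ 0) :
    cone a v e !₂[coneRad a v e x, coneProj a v e x] = x := by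
  have e1 := cross_expand h (x - a)
  have e2 : coneRad a v e x * coneProj a v e x = cross (v - a) (x - a) / cross (v - a) e := by
    rw [coneProj, mul_div_cancel₀ _ hx]
  have : cone a v e !₂[coneRad a v e x, coneProj a v e x] =
      a + (coneRad a v e x • (v - a) + (coneRad a v e x * coneProj a v e x) • e) := by
    simp only [cone, Matrix.cons_val_zero, Matrix.cons_val_one]
    module
  rw [this, e2, coneRad, ← e1]
  abel

theorem image_cone (L : ℝ) : cone a v e '' coneDom L = coneSet a v e L := by
  ext x
  constructor
  · rintro ⟨z, hz, rfl⟩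
    refine ⟨?_, ?_⟩
    · rw [coneRad_cone h]; exact hz.1
    · rw [coneProj_cone h hz.1.1.ne']; exact hz.2
  · intro hx
    exact ⟨_, ⟨by simpa using hx.1, by simpa using hx.2⟩, cone_coord h hx.1.1.ne'⟩

theorem injOn_cone (L : ℝ) : Set.InjOn (cone a v e) (coneDom L) := by
  intro z hz z' hz' he
  have e0 : z 0 = z' 0 := by rw [← coneRad_cone h z, ← coneRad_cone h z', he]
  have e1 : z 1 = z' 1 := by
    rw [← coneProj_cone h hz.1.1.ne', ← coneProj_cone h hz'.1.1.ne', he]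
  ext i
  fin_cases i
  · exact e0
  · exact e1

omit h

theorem continuous_coneRad : Continuous (coneRad a v e) :=
  (continuous_cross (continuous_id.sub continuous_const) continuous_const).div_const _

theorem measurable_coneProj : Measurable (coneProj a v e) :=
  ((continuous_cross continuous_const (continuous_id.sub continuous_const)).measurable.div_const
    _).div continuous_coneRad.measurable

theorem measurableSet_coneSet (L : ℝ) : MeasurableSet (coneSet a v e L) :=
  (continuous_coneRad.measurable measurableSet_Ioo).inter (measurable_coneProj measurableSet_Ioo)

theorem measurableSet_coneDom (L : ℝ) : MeasurableSet (coneDom L) :=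
  ((continuous_coord 0).measurable measurableSet_Ioo).inter
    ((continuous_coord 1).measurable measurableSet_Ioo)

theorem hasFDerivAt_cone (z : Plane) : HasFDerivAt (cone a v e)
    ((EuclideanSpace.proj 0 : Plane →L[ℝ] ℝ).smulRight (v + z 1 • e - a) +
      z 0 • (EuclideanSpace.proj 1 : Plane →L[ℝ] ℝ).smulRight e) z := by
  have h0 := (EuclideanSpace.proj 0 : Plane →L[ℝ] ℝ).hasFDerivAt (x := z)
  have h1 := (EuclideanSpace.proj 1 : Plane →L[ℝ] ℝ).hasFDerivAt (x := z)
  have := (h0.smul (((h1.smul_const e).const_add v).sub_const a)).const_add a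
  refine this.congr_fderiv ?_
  ext y i
  simp
  ring

theorem det_fderiv_cone (z : Plane) :
    ((EuclideanSpace.proj 0 : Plane →L[ℝ] ℝ).smulRight (v + z 1 • e - a) +
      z 0 • (EuclideanSpace.proj 1 : Plane →L[ℝ] ℝ).smulRight e).det = z 0 * cross (v - a) e := by
  rw [ContinuousLinearMap.det,
    ← LinearMap.det_toMatrix (EuclideanSpace.basisFun (Fin 2) ℝ).toBasis, Matrix.det_fin_two]
  simp [LinearMap.toMatrix_apply, cross]
  ring

end Cone

/-- The identification of `ℝ × ℝ` with the plane. -/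
noncomputable def prodPlane : ℝ × ℝ ≃ᵐ Plane :=
  MeasurableEquiv.finTwoArrow.symm.trans (MeasurableEquiv.toLp 2 (Fin 2 → ℝ))

theorem prodPlane_apply (p : ℝ × ℝ) : prodPlane p = !₂[p.1, p.2] := rfl

theorem measurePreserving_prodPlane : MeasurePreserving prodPlane :=
  (PiLp.volume_preserving_toLp (Fin 2)).comp (volume_preserving_finTwoArrow ℝ).symm

theorem prodPlane_preimage_coneDom (L : ℝ) :
    prodPlane ⁻¹' coneDom L = Set.Ioo (0 : ℝ) 1 ×ˢ Set.Ioo 0 L := by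
  ext p; simp [coneDom, prodPlane_apply, Set.mem_prod]

/-- Lebesgue measure on the parameter rectangle. -/
noncomputable abbrev rectVol (L : ℝ) : Measure (ℝ × ℝ) :=
  (volume.restrict (Set.Ioo (0 : ℝ) 1)).prod (volume.restrict (Set.Ioo (0 : ℝ) L))

theorem map_prodPlane (L : ℝ) :
    MeasurePreserving prodPlane (rectVol L) (volume.restrict (coneDom L)) := by
  have := measurePreserving_prodPlane.restrict_preimage (measurableSet_coneDom L)
  rwa [prodPlane_preimage_coneDom, Measure.volume_eq_prod, ← Measure.prod_restrict] at this

theorem integrableOn_coneSet_iff {a v e : Plane} (h : cross (v - a) e ≠ 0) (L : ℝ) (F : Plane → ℝ) :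
    IntegrableOn F (coneSet a v e L) ↔
      Integrable (fun p : ℝ × ℝ => |p.1 * cross (v - a) e| * F (cone a v e !₂[p.1, p.2]))
        (rectVol L) := by
  rw [← image_cone h, integrableOn_image_iff_integrableOn_abs_det_fderiv_smul volume
    (measurableSet_coneDom L) (fun z _ => (hasFDerivAt_cone z).hasFDerivWithinAt) (injOn_cone h L)]
  simp only [det_fderiv_cone]
  rw [IntegrableOn, ← (map_prodPlane L).integrable_comp_emb prodPlane.measurableEmbedding]
  rfl

/-- Integration over a triangle in radial coordinates. -/
theorem setIntegral_coneSet {a v e : Plane} (h : cross (v - a) e ≠ 0) (L : ℝ) (F : Plane → ℝ) :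
    ∫ x in coneSet a v e L, F x =
      ∫ p, |p.1 * cross (v - a) e| * F (cone a v e !₂[p.1, p.2]) ∂rectVol L := by
  rw [← image_cone h, integral_image_eq_integral_abs_det_fderiv_smul volume
    (measurableSet_coneDom L) (fun z _ => (hasFDerivAt_cone z).hasFDerivWithinAt) (injOn_cone h L)]
  simp only [det_fderiv_cone]
  rw [← (map_prodPlane L).integral_comp prodPlane.measurableEmbedding]
  rfl

theorem ae_rectVol (L : ℝ) : ∀ᵐ p ∂rectVol L, p.1 ∈ Set.Ioo (0 : ℝ) 1 ∧ p.2 ∈ Set.Ioo 0 L := by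
  rw [rectVol, Measure.prod_restrict]
  filter_upwards [ae_restrict_mem (measurableSet_Ioo.prod measurableSet_Ioo)] with p hp using hp

/-- The function that is constant along the rays from the apex and has the values `ψ` on the base of
the triangle, extended by zero. -/
noncomputable def coneLift (a v e : Plane) (L : ℝ) (ψ : ℝ → ℝ) : Plane → ℝ :=
  (coneSet a v e L).indicator fun x => ψ (coneProj a v e x)

/-- The radial field `ψ(s(x)) (x - a)` on the triangle, extended by zero. -/
noncomputable def coneField (a v e : Plane) (L : ℝ) (ψ : ℝ → ℝ) : Plane → Plane :=
  fun x => coneLift a v e L ψ x • (x - a)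

section ConeField

variable {a v e : Plane} {L : ℝ} {ψ : ℝ → ℝ}

theorem measurable_coneLift (hm : Measurable ψ) : Measurable (coneLift a v e L ψ) :=
  (hm.comp measurable_coneProj).indicator (measurableSet_coneSet L)

theorem measurable_coneField (hm : Measurable ψ) : Measurable (coneField a v e L ψ) :=
  (measurable_coneLift hm).smul (measurable_id.sub_const a)

theorem integrableOn_sq_coneProj (h : cross (v - a) e ≠ 0)
    (hψ : MemLp ψ 2 (volume.restrict (Set.Ioo 0 L))) :
    IntegrableOn (fun x => ψ (coneProj a v e x) ^ 2) (coneSet a v e L) := by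
  rw [integrableOn_coneSet_iff h]
  have hc : Integrable (fun t : ℝ => |t * cross (v - a) e|) (volume.restrict (Set.Ioo 0 1)) := by
    have : Continuous fun t : ℝ => |t * cross (v - a) e| := by fun_prop
    exact (this.integrableOn_Icc (a := 0) (b := 1)).mono_set Set.Ioo_subset_Icc_self
  refine (hc.mul_prod hψ.integrable_sq).congr ?_
  filter_upwards [ae_rectVol L] with p hp
  rw [coneProj_cone h (by simpa using hp.1.1.ne')]
  simp

theorem setIntegral_sq_coneProj (h : cross (v - a) e ≠ 0) :
    ∫ x in coneSet a v e L, ψ (coneProj a v e x) ^ 2 =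
      |cross (v - a) e| / 2 * ∫ s in Set.Ioo 0 L, ψ s ^ 2 := by
  rw [setIntegral_coneSet h]
  have e1 : ∫ p, |p.1 * cross (v - a) e| * ψ (coneProj a v e (cone a v e !₂[p.1, p.2])) ^ 2
      ∂rectVol L = ∫ p : ℝ × ℝ, (p.1 * |cross (v - a) e|) * ψ p.2 ^ 2 ∂rectVol L := by
    refine integral_congr_ae ?_
    filter_upwards [ae_rectVol L] with p hp
    rw [coneProj_cone h (by simpa using hp.1.1.ne'), abs_mul, abs_of_pos hp.1.1]
    simp
  rw [e1, integral_prod_mul (fun t : ℝ => t * |cross (v - a) e|) (fun s => ψ s ^ 2),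
    integral_mul_const]
  have e2 : ∫ t in Set.Ioo (0 : ℝ) 1, t = 1 / 2 := by
    rw [← integral_Ioc_eq_integral_Ioo, ← intervalIntegral.integral_of_le zero_le_one]
    simp
  rw [e2]; ring

theorem memLp_coneProj (h : cross (v - a) e ≠ 0) (hm : Measurable ψ)
    (hψ : MemLp ψ 2 (volume.restrict (Set.Ioo 0 L))) :
    MemLp (fun x => ψ (coneProj a v e x)) 2 (area (coneSet a v e L)) :=
  (memLp_two_iff_integrable_sq (hm.comp measurable_coneProj).aestronglyMeasurable).mpr
    (integrableOn_sq_coneProj h hψ)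

theorem memLp_coneLift (h : cross (v - a) e ≠ 0) (hm : Measurable ψ)
    (hψ : MemLp ψ 2 (volume.restrict (Set.Ioo 0 L))) : MemLp (coneLift a v e L ψ) 2 := by
  rw [coneLift, memLp_indicator_iff_restrict (measurableSet_coneSet L)]
  exact memLp_coneProj h hm hψ

theorem norm_coneField_le {R : ℝ} (hR : ∀ x ∈ coneSet a v e L, ‖x - a‖ ≤ R) (x : Plane) :
    ‖coneField a v e L ψ x‖ ≤ R * ‖coneLift a v e L ψ x‖ := by
  rw [coneField, norm_smul, mul_comm]
  by_cases hx : x ∈ coneSet a v e L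
  · gcongr; exact hR x hx
  · simp [coneLift, hx]

theorem memLp_coneField (h : cross (v - a) e ≠ 0) (hm : Measurable ψ)
    (hψ : MemLp ψ 2 (volume.restrict (Set.Ioo 0 L))) {R : ℝ}
    (hR : ∀ x ∈ coneSet a v e L, ‖x - a‖ ≤ R) : MemLp (coneField a v e L ψ) 2 :=
  (memLp_coneLift h hm hψ).of_le_mul (measurable_coneField hm).aestronglyMeasurable
    (ae_of_all _ fun x => norm_coneField_le hR x)

/-- Green's formula on a single ray: the integrand is the derivative of `t² φ(a + t y)`. -/
theorem integral_deriv_along_ray {φ : Plane → ℝ} (hφ : Smooth φ) (a y : Plane) :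
    ∫ t in Set.Ioo (0 : ℝ) 1, t * (inner ℝ (t • y) (gradient φ (a + t • y)) +
      2 * φ (a + t • y)) = φ (a + y) := by
  have hd : ∀ t : ℝ, HasDerivAt (fun t => t ^ 2 * φ (a + t • y))
      (t * (inner ℝ (t • y) (gradient φ (a + t • y)) + 2 * φ (a + t • y))) t := by
    intro t
    have h1 : HasDerivAt (fun t : ℝ => a + t • y) y t := by
      simpa using ((hasDerivAt_id t).smul_const y).const_add a
    have h2 := (hφ.differentiable (a + t • y)).hasFDerivAt.comp_hasDerivAt t h1
    have h3 := (hasDerivAt_pow 2 t).mul h2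
    refine h3.congr_deriv ?_
    rw [real_inner_smul_left, real_inner_comm, inner_gradient_left]
    simp
    ring
  have hc : Continuous fun t : ℝ => t * (inner ℝ (t • y) (gradient φ (a + t • y)) +
      2 * φ (a + t • y)) := by
    have c1 : Continuous fun t : ℝ => a + t • y := by fun_prop
    have c2 := hφ.continuous_gradient.comp c1
    have c3 := (ContDiff.continuous hφ).comp c1
    have c4 : Continuous fun t : ℝ => t • y := by fun_prop
    exact continuous_id.mul ((c4.inner c2).add (continuous_const.mul c3))
  rw [← integral_Ioc_eq_integral_Ioo, ← intervalIntegral.integral_of_le zero_le_one,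
    intervalIntegral.integral_eq_sub_of_hasDerivAt (fun t _ => hd t) (hc.intervalIntegrable _ _)]
  simp

/-- Green's formula for the radial field. No regularity of `ψ` is needed, because the field is
differentiated only along the rays. -/
theorem setIntegral_coneField_green (h : cross (v - a) e ≠ 0) (hm : Measurable ψ)
    (hψ : MemLp ψ 2 (volume.restrict (Set.Ioo 0 L))) (hb : Bornology.IsBounded (coneSet a v e L))
    {φ : Plane → ℝ} (hφ : Smooth φ) :
    ∫ x in coneSet a v e L, ψ (coneProj a v e x) *
        (inner ℝ (x - a) (gradient φ x) + 2 * φ x) =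
      |cross (v - a) e| * ∫ s in Set.Ioo 0 L, ψ s * φ (v + s • e) := by
  have hc : Continuous fun x => inner ℝ (x - a) (gradient φ x) + 2 * φ x :=
    ((continuous_id.sub continuous_const).inner hφ.continuous_gradient).add
      (continuous_const.mul (ContDiff.continuous hφ))
  have hI : IntegrableOn (fun x => ψ (coneProj a v e x) *
      (inner ℝ (x - a) (gradient φ x) + 2 * φ x)) (coneSet a v e L) :=
    (memLp_coneProj h hm hψ).integrable_mul (memLp_of_continuous hb hc)
  rw [integrableOn_coneSet_iff h] at hI
  rw [setIntegral_coneSet h, integral_prod_symm _ hI, ← integral_const_mul]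
  refine integral_congr_ae (ae_of_all _ fun s => ?_)
  simp only
  have hr := integral_deriv_along_ray hφ a (v + s • e - a)
  rw [add_sub_cancel] at hr
  rw [← hr, ← mul_assoc, ← integral_const_mul]
  refine setIntegral_congr_fun measurableSet_Ioo fun t ht => ?_
  have ec : cone a v e !₂[t, s] = a + t • (v + s • e - a) := rfl
  simp only [coneProj_cone h (z := !₂[t, s]) (by simpa using ht.1.ne')]
  rw [ec, add_sub_cancel_left, abs_mul, abs_of_pos ht.1]
  simp
  ring

/-- The pairing of the radial field and its divergence with `F` and `f`, written on the triangle. -/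
theorem setIntegral_coneField_pairing {Ω : Set Plane} (hΩ : MeasurableSet Ω)
    (hT : coneSet a v e L ⊆ Ω) (F : Plane → Plane) (f : Plane → ℝ) :
    ∫ x in Ω, (inner ℝ (coneField a v e L ψ x) (F x) + 2 * coneLift a v e L ψ x * f x) =
      ∫ x in coneSet a v e L, ψ (coneProj a v e x) * (inner ℝ (x - a) (F x) + 2 * f x) := by
  rw [setIntegral_eq_of_subset_of_forall_sdiff_eq_zero hΩ hT]
  · refine setIntegral_congr_fun (measurableSet_coneSet L) fun x hx => ?_
    simp only [coneField, coneLift, Set.indicator_of_mem hx, real_inner_smul_left]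
    ring
  · intro x hx
    simp [coneField, coneLift, hx.2]

end ConeField

/-! ### Passage to the limit in `L²`, and arc length on a line -/

theorem integrable_inner_of_memLp {X : Type*} [MeasurableSpace X] {μ : Measure X} {F : Type*}
    [NormedAddCommGroup F] [InnerProductSpace ℝ F] {f g : X → F} (hf : MemLp f 2 μ)
    (hg : MemLp g 2 μ) : Integrable (fun x => inner ℝ (f x) (g x)) μ := by
  refine (L2.integrable_inner (𝕜 := ℝ) (hf.toLp f) (hg.toLp g)).congr ?_
  filter_upwards [hf.coeFn_toLp, hg.coeFn_toLp] with x h1 h2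
  rw [h1, h2]

theorem integrable_mul_of_memLp {X : Type*} [MeasurableSpace X] {μ : Measure X} {f g : X → ℝ}
    (hf : MemLp f 2 μ) (hg : MemLp g 2 μ) : Integrable (fun x => f x * g x) μ :=
  hf.integrable_mul hg

theorem tendsto_integral_inner {X : Type*} [MeasurableSpace X] {μ : Measure X} {F : Type*}
    [NormedAddCommGroup F] [InnerProductSpace ℝ F] {f : ℕ → X → F} {g k : X → F}
    (hf : ∀ n, MemLp (f n) 2 μ) (hg : MemLp g 2 μ) (hk : MemLp k 2 μ)
    (h : Tendsto (fun n => eLpNorm (fun x => f n x - g x) 2 μ) atTop (𝓝 0)) :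
    Tendsto (fun n => ∫ x, inner ℝ (k x) (f n x) ∂μ) atTop (𝓝 (∫ x, inner ℝ (k x) (g x) ∂μ)) := by
  have h1 := (Lp.tendsto_Lp_iff_tendsto_eLpNorm'' f hf g hg).mpr h
  have h2 : ∀ (u : X → F) (hu : MemLp u 2 μ),
      inner ℝ (hk.toLp k) (hu.toLp u) = ∫ x, inner ℝ (k x) (u x) ∂μ := by
    intro u hu
    rw [L2.inner_def]
    refine integral_congr_ae ?_
    filter_upwards [hk.coeFn_toLp, hu.coeFn_toLp] with x h3 h4
    rw [h3, h4]
  simp only [← h2 _ (hf _), ← h2 _ hg]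
  exact (tendsto_const_nhds (x := hk.toLp k)).inner h1

theorem isometry_line (v : Plane) {e : Plane} (he : ‖e‖ = 1) : Isometry fun s : ℝ => v + s • e :=
  Isometry.of_dist_eq fun s t => by
    rw [dist_add_left, dist_eq_norm, ← sub_smul, norm_smul, he, mul_one, Real.dist_eq,
      Real.norm_eq_abs]

/-- Arc length on a segment is the image of Lebesgue measure under the unit-speed parametrization. -/
theorem map_line (v : Plane) {e : Plane} (he : ‖e‖ = 1) (L : ℝ) :
    Measure.map (fun s : ℝ => v + s • e) (volume.restrict (Set.Ioo 0 L)) =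
      arc ((fun s : ℝ => v + s • e) '' Set.Ioo 0 L) := by
  have hi := isometry_line v he
  have hemb : MeasurableEmbedding fun s : ℝ => v + s • e := hi.isClosedEmbedding.measurableEmbedding
  have hA : MeasurableSet ((fun s : ℝ => v + s • e) '' Set.Ioo 0 L) :=
    hemb.measurableSet_image.mpr measurableSet_Ioo
  have h1 := hi.map_hausdorffMeasure (d := 1) (Or.inl zero_le_one)
  rw [hausdorffMeasure_real] at h1
  have h2 : Set.Ioo 0 L = (fun s : ℝ => v + s • e) ⁻¹' ((fun s : ℝ => v + s • e) '' Set.Ioo 0 L) :=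
    (Set.preimage_image_eq _ hi.injective).symm
  conv_lhs => rw [h2]
  rw [← Measure.restrict_map hemb.measurable hA, h1, Measure.restrict_restrict hA,
    Set.inter_eq_left.mpr (Set.image_subset_range _ _)]

/-! ### Radial fields as test functions -/

section BoundaryEstimate

variable {Ω ΓD : Set Plane} {a v e : Plane} {L : ℝ} {ψ : ℝ → ℝ}

theorem exists_norm_sub_le (hb : Bornology.IsBounded Ω) (hT : coneSet a v e L ⊆ Ω) :
    ∃ R, ∀ x ∈ coneSet a v e L, ‖x - a‖ ≤ R := by
  obtain ⟨R, hR⟩ := (hb.subset hT).subset_closedBall a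
  exact ⟨R, fun x hx => by simpa [dist_eq_norm] using hR hx⟩

theorem measurableEmbedding_line (v : Plane) {e : Plane} (he : ‖e‖ = 1) :
    MeasurableEmbedding fun s : ℝ => v + s • e :=
  (isometry_line v he).isClosedEmbedding.measurableEmbedding

theorem memLp_line {S : Set Plane} (he : ‖e‖ = 1)
    (hS : (fun s : ℝ => v + s • e) '' Set.Ioo 0 L ⊆ S) {g : Plane → ℝ} (hg : MemLp g 2 (arc S)) :
    MemLp (fun s => g (v + s • e)) 2 (volume.restrict (Set.Ioo 0 L)) := by
  have h1 : MemLp g 2 (arc ((fun s : ℝ => v + s • e) '' Set.Ioo 0 L)) :=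
    hg.mono_measure (Measure.restrict_mono hS le_rfl)
  rw [← map_line v he] at h1
  exact (measurableEmbedding_line v he).memLp_map_measure_iff.mp h1

theorem eLpNorm_line_le {S : Set Plane} (he : ‖e‖ = 1)
    (hS : (fun s : ℝ => v + s • e) '' Set.Ioo 0 L ⊆ S) (g : Plane → ℝ) :
    eLpNorm (fun s => g (v + s • e)) 2 (volume.restrict (Set.Ioo 0 L)) ≤ eLpNorm g 2 (arc S) := by
  have h1 : eLpNorm g 2 (arc ((fun s : ℝ => v + s • e) '' Set.Ioo 0 L)) ≤ eLpNorm g 2 (arc S) :=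
    eLpNorm_mono_measure _ (Measure.restrict_mono hS le_rfl)
  rwa [← map_line v he, (measurableEmbedding_line v he).eLpNorm_map_measure] at h1

theorem memLp_line_of_continuous {φ : ℝ → ℝ} (hφ : Continuous φ) :
    MemLp φ 2 (volume.restrict (Set.Ioo 0 L)) := by
  obtain ⟨C, hC⟩ := (isCompact_Icc (a := (0 : ℝ)) (b := L)).exists_bound_of_continuousOn
    hφ.continuousOn
  exact MemLp.of_bound hφ.aestronglyMeasurable C ((ae_restrict_iff' measurableSet_Ioo).mpr
    (ae_of_all _ fun x hx => hC x (Set.Ioo_subset_Icc_self hx)))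

/-- The normal trace of the radial field is carried by the base of the triangle, with density
`|cross (v - a) e| ψ`, the factor being the height of the triangle. -/
theorem integral_coneField_trace (hΩ : IsOpen Ω) (hb : Bornology.IsBounded Ω)
    (hT : coneSet a v e L ⊆ Ω) (h : cross (v - a) e ≠ 0) (he : ‖e‖ = 1) (hm : Measurable ψ)
    (hψ : MemLp ψ 2 (volume.restrict (Set.Ioo 0 L)))
    (hS : (fun s : ℝ => v + s • e) '' Set.Ioo 0 L ⊆ ΓD) {w g : Plane → ℝ} {Dw : Plane → Plane}
    (hw : HasTrace Ω ΓD w Dw g) :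
    ∫ x in Ω, (inner ℝ (coneField a v e L ψ x) (Dw x) + 2 * coneLift a v e L ψ x * w x) =
      |cross (v - a) e| * ∫ s in Set.Ioo 0 L, ψ s * g (v + s • e) := by
  obtain ⟨hwg, hg, φ, hφ, t1, t2, t3⟩ := hw
  obtain ⟨R, hR⟩ := exists_norm_sub_le hb hT
  have mF : MemLp (coneField a v e L ψ) 2 (area Ω) := (memLp_coneField h hm hψ hR).restrict _
  have mf : MemLp (fun x => 2 * coneLift a v e L ψ x) 2 (area Ω) :=
    ((memLp_coneLift h hm hψ).restrict _).const_mul 2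
  have cl : Continuous fun s : ℝ => v + s • e := by fun_prop
  have l1 := tendsto_integral_inner (fun n => memLp_of_continuous hb
    (hφ n).continuous_gradient) hwg.2.1 mF t2
  have l2 := tendsto_integral_inner (fun n => memLp_of_continuous hb
    (ContDiff.continuous (hφ n))) hwg.1 mf t1
  have l3 := tendsto_integral_inner (fun n => memLp_line_of_continuous
    ((ContDiff.continuous (hφ n)).comp cl)) (memLp_line he hS hg) hψ
    (tendsto_of_tendsto_of_tendsto_of_le_of_le tendsto_const_nhds t3 (fun _ => zero_le)
      fun n => eLpNorm_line_le he hS fun x => φ n x - g x)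
  have I : ∀ {z : Plane → ℝ} {Dz : Plane → Plane}, MemLp z 2 (area Ω) → MemLp Dz 2 (area Ω) →
      (∫ x in Ω, inner ℝ (coneField a v e L ψ x) (Dz x)) +
        (∫ x in Ω, inner ℝ (2 * coneLift a v e L ψ x) (z x)) =
      ∫ x in Ω, (inner ℝ (coneField a v e L ψ x) (Dz x) + 2 * coneLift a v e L ψ x * z x) := by
    intro z Dz hz hDz
    rw [← integral_add (integrable_inner_of_memLp mF hDz) (integrable_inner_of_memLp mf hz)]
    simp [mul_comm]
  have l12 := l1.add l2
  rw [I hwg.1 hwg.2.1] at l12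
  refine tendsto_nhds_unique l12 (((l3.const_mul |cross (v - a) e|).congr fun n => ?_).trans ?_)
  · rw [I (memLp_of_continuous hb (ContDiff.continuous (hφ n)))
      (memLp_of_continuous hb (hφ n).continuous_gradient),
      setIntegral_coneField_pairing hΩ.measurableSet hT,
      setIntegral_coneField_green h hm hψ (hb.subset hT) (hφ n)]
    simp [mul_comm]
  · simp [mul_comm]

/-- A radial field on a triangle in `Ω` with base on `ΓD` belongs to the space `H`. -/
theorem coneField_inH (hΩ : IsOpen Ω) (hb : Bornology.IsBounded Ω)
    (hT : coneSet a v e L ⊆ Ω) (h : cross (v - a) e ≠ 0) (he : ‖e‖ = 1) (hm : Measurable ψ)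
    (hψ : MemLp ψ 2 (volume.restrict (Set.Ioo 0 L)))
    (hS : (fun s : ℝ => v + s • e) '' Set.Ioo 0 L ⊆ ΓD) (hΓ : ΓD ⊆ frontier Ω) :
    InH Ω ΓD (coneField a v e L ψ) (fun x => 2 * coneLift a v e L ψ x) := by
  obtain ⟨R, hR⟩ := exists_norm_sub_le hb hT
  have mF : MemLp (coneField a v e L ψ) 2 (area Ω) := (memLp_coneField h hm hψ hR).restrict _
  have mf : MemLp (fun x => 2 * coneLift a v e L ψ x) 2 (area Ω) :=
    ((memLp_coneLift h hm hψ).restrict _).const_mul 2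
  refine ⟨⟨mF, mf, fun φ hφ => ?_⟩, fun w Dw hw => ?_⟩
  · have i1 := integrable_inner_of_memLp mF (memLp_of_continuous hb hφ.1.continuous_gradient)
    have i2 : Integrable (fun x => 2 * coneLift a v e L ψ x * φ x) (area Ω) :=
      mf.integrable_mul (memLp_of_continuous hb (ContDiff.continuous hφ.1))
    rw [← add_eq_zero_iff_eq_neg, ← integral_add i1 i2,
      setIntegral_coneField_pairing hΩ.measurableSet hT,
      setIntegral_coneField_green h hm hψ (hb.subset hT) hφ.1]
    -- the base lies on the boundary, where the test function vanishes
    have : ∫ s in Set.Ioo 0 L, ψ s * φ (v + s • e) = 0 := by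
      refine setIntegral_eq_zero_of_forall_eq_zero fun s hs => ?_
      have hn : v + s • e ∉ Ω := fun hin =>
        (hΩ.frontier_eq ▸ hΓ (hS ⟨s, hs, rfl⟩)).2 hin
      rw [image_eq_zero_of_notMem_tsupport fun ht => hn (hφ.2.2 ht), mul_zero]
    rw [this, mul_zero]
  · rw [integral_coneField_trace hΩ hb hT h he hm hψ hS hw]
    simp

/-- Trace estimate on an edge on `ΓD`: testing the mixed formulation with the radial field whose
values on the base are those of `g - p`. -/
theorem boundary_estimate {κ : Plane → Matrix (Fin 2) (Fin 2) ℝ} (hκ : IsDiffusionTensor Ω κ)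
    {f g : Plane → ℝ} (hg : InHHalf Ω ΓD g) {σ : Plane → Plane} {dσ u : Plane → ℝ}
    (hsol : IsMixedSolution Ω ΓD κ f g σ dσ u)
    (hΩ : IsOpen Ω) (hb : Bornology.IsBounded Ω) {U : Set Plane} (hUΩ : U ⊆ Ω)
    (hT : coneSet a v e L ⊆ U) (h : cross (v - a) e ≠ 0) (he : ‖e‖ = 1)
    (hS : (fun s : ℝ => v + s • e) '' Set.Ioo 0 L ⊆ ΓD) (hΓ : ΓD ⊆ frontier Ω) {R : ℝ}
    (hR : ∀ x ∈ coneSet a v e L, ‖x - a‖ ≤ R) (p : Poly2) :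
    |cross (v - a) e| * (∫ s in Set.Ioo 0 L, (g (v + s • e) - ev p (v + s • e)) ^ 2) ≤
      4 / 3 * (R ^ 2 * (∫ x in U, ‖mulV (κ x)⁻¹ (σ x) - vev (polyGrad p) x‖ ^ 2) +
        4 * ∫ x in U, (u x - ev p x) ^ 2) := by
  obtain ⟨⟨w, Dw⟩, hw⟩ := hg
  have hTΩ := hT.trans hUΩ
  have hG : HasGradL2 Ω u (fun x => mulV (κ x)⁻¹ (σ x)) :=
    hsol.hasGradL2 hb hκ ⟨⟨w, Dw⟩, hw⟩
  have hp : HasGradL2 Ω (ev p) (vev (polyGrad p)) := by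
    have := (smooth_ev p).hasGradL2 hb
    rwa [show gradient (ev p) = vev (polyGrad p) from funext (gradient_ev p)] at this
  have hd := hG.sub hp
  have cl : Continuous fun s : ℝ => v + s • e := by fun_prop
  have mgl := memLp_line he hS hw.2.1
  have mpl : MemLp (fun s => ev p (v + s • e)) 2 (volume.restrict (Set.Ioo 0 L)) :=
    memLp_line_of_continuous ((ContDiff.continuous (smooth_ev p)).comp cl)
  have md := mgl.sub mpl
  -- a measurable representative of the boundary values of `g - p`
  obtain ⟨ψ, hmψ, hae⟩ : ∃ ψ : ℝ → ℝ, Measurable ψ ∧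
      (fun s => g (v + s • e) - ev p (v + s • e)) =ᵐ[volume.restrict (Set.Ioo 0 L)] ψ :=
    ⟨md.1.mk _, md.1.stronglyMeasurable_mk.measurable, md.1.ae_eq_mk⟩
  have hψ : MemLp ψ 2 (volume.restrict (Set.Ioo 0 L)) := (memLp_congr_ae hae).mp md
  have hH := coneField_inH hΩ hb hTΩ h he hmψ hψ hS hΓ
  have iu : Integrable (fun x => u x * (2 * coneLift a v e L ψ x)) (area Ω) :=
    hG.1.integrable_mul hH.1.2.1
  have e1 := hsol.first _ _ hH
  rw [dirichletPairing_eq hH hw, integral_coneField_trace hΩ hb hTΩ h he hmψ hψ hS hw, aForm,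
    ← integral_add (integrable_inner_of_memLp hG.2.1 hH.1.1) iu] at e1
  simp only [real_inner_comm (coneField a v e L ψ _), mul_comm (u _)] at e1
  rw [setIntegral_coneField_pairing hΩ.measurableSet hTΩ] at e1
  have e2 := setIntegral_coneField_green h hmψ hψ (hb.subset hTΩ) (smooth_ev p)
  simp only [gradient_ev] at e2
  have mψ := memLp_coneProj h hmψ hψ
  have hdT := hd.mono hTΩ
  have mq : ∀ {W : Plane → Plane}, MemLp W 2 (area (coneSet a v e L)) →
      MemLp (fun x => inner ℝ (x - a) (W x)) 2 (area (coneSet a v e L)) := by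
    intro W hW
    refine hW.of_le_mul (c := R) ((continuous_id.sub
      continuous_const).aestronglyMeasurable.inner hW.1) ?_
    filter_upwards [ae_restrict_mem (measurableSet_coneSet L)] with x hx
    exact (norm_inner_le_norm _ _).trans (by gcongr; exact hR x hx)
  have mq1 := mq hdT.2.1
  have mq2 : MemLp (fun x => 2 * (u x - ev p x)) 2 (area (coneSet a v e L)) := hdT.1.const_mul 2
  have i1 : Integrable (fun x => ψ (coneProj a v e x) *
      (inner ℝ (x - a) (mulV (κ x)⁻¹ (σ x)) + 2 * u x)) (area (coneSet a v e L)) :=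
    mψ.integrable_mul ((mq (hG.mono hTΩ).2.1).add ((hG.mono hTΩ).1.const_mul 2))
  have i2 : Integrable (fun x => ψ (coneProj a v e x) *
      (inner ℝ (x - a) (vev (polyGrad p) x) + 2 * ev p x)) (area (coneSet a v e L)) :=
    mψ.integrable_mul ((mq (hp.mono hTΩ).2.1).add ((hp.mono hTΩ).1.const_mul 2))
  set S := |cross (v - a) e| * ∫ s in Set.Ioo 0 L, ψ s ^ 2 with hSdef
  have key : S = (∫ x in coneSet a v e L,
        inner ℝ (x - a) (mulV (κ x)⁻¹ (σ x) - vev (polyGrad p) x) * ψ (coneProj a v e x)) +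
      ∫ x in coneSet a v e L, 2 * (u x - ev p x) * ψ (coneProj a v e x) := by
    rw [← integral_add (integrable_mul_of_memLp mq1 mψ) (integrable_mul_of_memLp mq2 mψ)]
    have e3 : S = |cross (v - a) e| * (∫ s in Set.Ioo 0 L, ψ s * g (v + s • e)) -
        |cross (v - a) e| * ∫ s in Set.Ioo 0 L, ψ s * ev p (v + s • e) := by
      rw [← mul_sub, ← integral_sub (integrable_mul_of_memLp hψ mgl)
        (integrable_mul_of_memLp hψ mpl), hSdef]
      congr 1
      refine integral_congr_ae ?_
      filter_upwards [hae] with s hs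
      rw [sq]; nth_rw 2 [← hs]; ring
    rw [e3, ← e1, ← e2, ← integral_sub i1 i2]
    refine integral_congr_ae (ae_of_all _ fun x => ?_)
    simp only [inner_sub_right]
    ring
  have y1 := integral_mul_le_young mq1 mψ one_pos
  have y2 := integral_mul_le_young mq2 mψ one_pos
  rw [setIntegral_sq_coneProj h] at y1 y2
  have b1 : ∫ x in coneSet a v e L,
      (inner ℝ (x - a) (mulV (κ x)⁻¹ (σ x) - vev (polyGrad p) x)) ^ 2 ≤
      R ^ 2 * ∫ x in U, ‖mulV (κ x)⁻¹ (σ x) - vev (polyGrad p) x‖ ^ 2 := by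
    calc _ ≤ ∫ x in coneSet a v e L,
          R ^ 2 * ‖mulV (κ x)⁻¹ (σ x) - vev (polyGrad p) x‖ ^ 2 := by
          refine setIntegral_mono_on mq1.integrable_sq (hdT.2.1.norm.integrable_sq.const_mul _)
            (measurableSet_coneSet L) fun x hx => ?_
          rw [← mul_pow, ← sq_abs]
          gcongr
          exact (abs_real_inner_le_norm _ _).trans (by gcongr; exact hR x hx)
      _ ≤ _ := by
          rw [integral_const_mul]
          gcongr ?_ * ?_
          exact setIntegral_mono_set (hd.mono hUΩ).2.1.norm.integrable_sq
            (ae_of_all _ fun x => sq_nonneg _) (LE.le.eventuallyLE hT)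
  have b2 : ∫ x in coneSet a v e L, (2 * (u x - ev p x)) ^ 2 ≤
      4 * ∫ x in U, (u x - ev p x) ^ 2 := by
    simp only [mul_pow]
    rw [integral_const_mul]
    have : ∫ x in coneSet a v e L, (u x - ev p x) ^ 2 ≤ ∫ x in U, (u x - ev p x) ^ 2 :=
      setIntegral_mono_set (hd.mono hUΩ).1.integrable_sq
        (ae_of_all _ fun x => sq_nonneg _) (LE.le.eventuallyLE hT)
    linarith
  have hfin : |cross (v - a) e| *
      (∫ s in Set.Ioo 0 L, (g (v + s • e) - ev p (v + s • e)) ^ 2) = S := by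
    rw [hSdef]
    congr 1
    refine integral_congr_ae ?_
    filter_upwards [hae] with s hs
    rw [hs]
  rw [hfin]
  have hS2 : |cross (v - a) e| / 2 * ∫ s in Set.Ioo 0 L, ψ s ^ 2 = S / 2 := by
    rw [hSdef]; ring
  rw [hS2] at y1 y2
  linarith

end BoundaryEstimate

/-! ### Geometry of star-shaped polygons -/

theorem Polygon.subset_closedBall (K : Polygon) {b : Plane} (hb : b ∈ K.carrier) :
    K.carrier ⊆ Metric.closedBall b K.diam := fun _ hx =>
  Metric.dist_le_diam_of_mem K.isBounded hx hb

theorem Polygon.diam_pos (K : Polygon) : 0 < K.diam := by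
  obtain ⟨b, hb⟩ := K.isConnected.nonempty
  refine lt_of_le_of_ne Metric.diam_nonneg fun h0 => ?_
  have hsub := K.subset_closedBall hb
  rw [← h0, Metric.closedBall_zero] at hsub
  obtain ⟨ε, hε, hball⟩ := Metric.isOpen_iff.mp K.isOpen b hb
  have hm : b + EuclideanSpace.single 0 (ε / 2) ∈ Metric.ball b ε := by
    simp [abs_of_pos hε, hε]
  have := hsub (hball hm)
  simp [hε.ne'] at this

theorem Polygon.segment_subset_frontier (K : Polygon) (i : Fin (K.extra + 3)) :
    K.edge i ⊆ frontier K.carrier := by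
  rw [K.frontier_eq]
  exact Set.subset_iUnion (fun i => segment ℝ (K.vertex i) (K.vertex (i + 1))) i

theorem Polygon.edgeLength_le_diam (K : Polygon) (i : Fin (K.extra + 3)) :
    K.edgeLength i ≤ K.diam := by
  have h := (K.segment_subset_frontier i).trans frontier_subset_closure
  rw [Polygon.diam, ← Metric.diam_closure]
  exact Metric.dist_le_diam_of_mem K.isBounded.closure (h (left_mem_segment ℝ _ _))
    (h (right_mem_segment ℝ _ _))

/-- If `K` is star-shaped with respect to all points of a disc, the half-open segment from a point of
the disc to a boundary point of `K` lies in `K`. -/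
theorem mem_of_starConvex_ball {K : Set Plane} {b : Plane} {δ : ℝ}
    (hK : ∀ y ∈ Metric.ball b δ, StarConvex ℝ y K) {a : Plane} (ha : a ∈ Metric.ball b δ)
    {s : Plane} (hs : s ∈ closure K) {t : ℝ} (ht0 : 0 ≤ t) (ht1 : t < 1) :
    a + t • (s - a) ∈ K := by
  -- the apex is moved slightly so that the same point is seen through a point `s'` of `K`
  have hc : Continuous fun s' : Plane => a + (t / (1 - t)) • (s - s') := by fun_prop
  have hopen : IsOpen ((fun s' : Plane => a + (t / (1 - t)) • (s - s')) ⁻¹' Metric.ball b δ) :=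
    Metric.isOpen_ball.preimage hc
  obtain ⟨s', hs'1, hs'2⟩ := mem_closure_iff.mp hs _ hopen (by simpa using ha)
  have := hK _ hs'1 hs'2 (sub_nonneg.mpr ht1.le) ht0 (by ring)
  convert this using 1
  have h1 : 1 - t ≠ 0 := by linarith
  rw [smul_add, smul_smul, mul_div_cancel₀ _ h1]
  module

/-- A disc of radius `δ` contains a point at distance at least `δ / 2` from a given line. -/
theorem exists_apex (b v : Plane) {e : Plane} (he : ‖e‖ = 1) {δ : ℝ} (hδ : 0 < δ) :
    ∃ a ∈ Metric.ball b δ, δ / 2 ≤ |cross (v - a) e| := by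
  have he2 : e 0 ^ 2 + e 1 ^ 2 = 1 := by rw [← normSq_plane, he, one_pow]
  have key : ∀ t : ℝ, |t| = 1 → b + (t * (δ / 2)) • (!₂[-e 1, e 0] : Plane) ∈ Metric.ball b δ ∧
      cross (v - (b + (t * (δ / 2)) • (!₂[-e 1, e 0] : Plane))) e =
        cross (v - b) e + t * (δ / 2) := by
    intro t ht
    have hn : ‖(!₂[-e 1, e 0] : Plane)‖ = 1 := by
      have : ‖(!₂[-e 1, e 0] : Plane)‖ ^ 2 = 1 := by
        rw [normSq_plane]; simp; linarith
      nlinarith [norm_nonneg (!₂[-e 1, e 0] : Plane)]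
    refine ⟨?_, ?_⟩
    · rw [mem_ball_iff_norm, add_sub_cancel_left, norm_smul, hn, Real.norm_eq_abs, abs_mul, ht,
        abs_of_pos (by positivity)]
      linarith
    · have : t * (δ / 2) = t * (δ / 2) * (e 0 ^ 2 + e 1 ^ 2) := by rw [he2, mul_one]
      rw [this]
      simp [cross]
      nlinarith [he2]
  rcases le_total 0 (cross (v - b) e) with h0 | h0
  · obtain ⟨k1, k2⟩ := key 1 (by simp)
    refine ⟨_, k1, ?_⟩
    rw [k2, abs_of_nonneg (by linarith)]
    linarith
  · obtain ⟨k1, k2⟩ := key (-1) (by simp)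
    refine ⟨_, k1, ?_⟩
    rw [k2, abs_of_nonpos (by linarith)]
    linarith

theorem image_line_eq_openSegment {x y e : Plane} {L : ℝ} (hL : 0 < L) (hy : y = x + L • e) :
    (fun s : ℝ => x + s • e) '' Set.Ioo 0 L = openSegment ℝ x y := by
  rw [openSegment_eq_image', hy, add_sub_cancel_left]
  ext z
  constructor
  · rintro ⟨s, hs, rfl⟩
    refine ⟨s / L, ⟨div_pos hs.1 hL, (div_lt_one hL).mpr hs.2⟩, ?_⟩
    simp only [smul_smul]
    rw [div_mul_cancel₀ _ hL.ne']
  · rintro ⟨s, hs, rfl⟩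
    refine ⟨s * L, ⟨mul_pos hs.1 hL, ?_⟩, ?_⟩
    · nlinarith [hs.2]
    · simp only [smul_smul]

theorem arc_segment (x y : Plane) : arc (segment ℝ x y) = arc (openSegment ℝ x y) := by
  refine Measure.restrict_congr_set ?_
  have := Measure.nullSingletonClass_hausdorff Plane (d := 1) one_pos
  have h0 : (Measure.hausdorffMeasure 1 : Measure Plane) {x, y} = 0 :=
    (Set.toFinite {x, y}).measure_zero _
  have hu : segment ℝ x y = {x, y} ∪ openSegment ℝ x y := by
    rw [← insert_endpoints_openSegment, Set.insert_union, Set.singleton_union]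
  rw [hu]
  exact union_ae_eq_right_of_ae_eq_empty (ae_eq_empty.mpr h0)

theorem coneSet_subset {K : Set Plane} {b : Plane} {δ : ℝ}
    (hK : ∀ y ∈ Metric.ball b δ, StarConvex ℝ y K) {a : Plane} (ha : a ∈ Metric.ball b δ)
    {v e : Plane} {L : ℝ} (h : cross (v - a) e ≠ 0)
    (hcl : (fun s : ℝ => v + s • e) '' Set.Ioo 0 L ⊆ closure K) : coneSet a v e L ⊆ K := by
  rw [← image_cone h]
  rintro _ ⟨z, hz, rfl⟩
  exact mem_of_starConvex_ball hK ha (hcl ⟨z 1, hz.2, rfl⟩) hz.1.1.le hz.1.2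

theorem Mesh.elem_subset {Ω ΓD ΓN : Set Plane} (hΩ : IsPolygonalDomain Ω) (T : Mesh Ω ΓD ΓN)
    (j : Fin T.card) : (T.elem j).carrier ⊆ Ω := by
  refine (interior_maximal (t := (T.elem j).carrier) ?_ (T.elem j).isOpen).trans hΩ.noSlit.subset
  rw [T.cover]
  exact subset_closure.trans (Set.subset_iUnion (fun j => closure (T.elem j).carrier) j)

/-! ### The local estimates -/

theorem totalDegree_pderiv_le (i : Fin 2) (p : Poly2) :
    (MvPolynomial.pderiv i p).totalDegree ≤ p.totalDegree := by
  conv_lhs => rw [p.as_sum, map_sum]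
  refine MvPolynomial.totalDegree_finsetSum_le fun α hα => ?_
  rw [MvPolynomial.pderiv_monomial]
  refine (MvPolynomial.totalDegree_monomial_le _ _).trans
    (le_trans ?_ (MvPolynomial.le_totalDegree hα))
  exact Finsupp.degree_mono (tsub_le_self : α - Finsupp.single i 1 ≤ α)

theorem totalDegree_residual_le {k m : ℕ} {A : Matrix (Fin 2) (Fin 2) Poly2}
    (hA : ∀ a b, DegLT (m + 1) (A a b)) {s : VPoly2} (hs : VDegLT (k + 2) s) {p : Poly2}
    (hp : DegLT (k + 1) p) (i : Fin 2) :
    (polyMulV A s i - polyGrad p i).totalDegree ≤ m + k + 1 := by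
  have hj : ∀ j, (A i j * s j).totalDegree ≤ m + k + 1 := fun j =>
    (MvPolynomial.totalDegree_mul _ _).trans (by
      have := degLT_succ_iff.mp (hA i j)
      have := degLT_succ_iff.mp (hs j)
      omega)
  refine (MvPolynomial.totalDegree_sub _ _).trans (max_le ?_ ?_)
  · simp only [polyMulV, Matrix.mulVec, dotProduct, Fin.sum_univ_two]
    exact (MvPolynomial.totalDegree_add _ _).trans (max_le (hj 0) (hj 1))
  · have := degLT_succ_iff.mp hp
    exact (totalDegree_pderiv_le i p).trans (by omega)

theorem setIntegral_norm_sq {U : Set Plane} {F : Plane → Plane} (hF : MemLp F 2 (area U)) :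
    ∫ x in U, ‖F x‖ ^ 2 = (∫ x in U, F x 0 ^ 2) + ∫ x in U, F x 1 ^ 2 := by
  rw [← integral_add (MemLp.coord hF 0).integrable_sq (MemLp.coord hF 1).integrable_sq]
  simp only [normSq_plane]

theorem setIntegral_norm_add_sq_le {U : Set Plane} {F G : Plane → Plane} (hF : MemLp F 2 (area U))
    (hG : MemLp G 2 (area U)) :
    ∫ x in U, ‖F x + G x‖ ^ 2 ≤ 2 * (∫ x in U, ‖F x‖ ^ 2) + 2 * ∫ x in U, ‖G x‖ ^ 2 := by
  rw [← integral_const_mul, ← integral_const_mul, ← integral_add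
    (hF.norm.integrable_sq.const_mul _) (hG.norm.integrable_sq.const_mul _)]
  refine integral_mono (hF.add hG).norm.integrable_sq ((hF.norm.integrable_sq.const_mul _).add
    (hG.norm.integrable_sq.const_mul _)) fun x => ?_
  have := parallelogram_law_with_norm ℝ (F x) (G x)
  have := sq_nonneg ‖F x - G x‖
  beta_reduce
  nlinarith

theorem continuous_vev (p : VPoly2) : Continuous (vev p) := by
  have : Continuous fun x : Plane => fun i => ev (p i) x :=
    continuous_pi fun i => ContDiff.continuous (smooth_ev (p i))
  exact (PiLp.continuous_toLp 2 (fun _ : Fin 2 => ℝ)).comp this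

/-- The discrete residual `κ_h s - ∇p` and the defect `κ⁻¹ σ - κ_h s` are both bounded by the local
error: the defect directly, the residual by the interior estimate for `v = u - p`. -/
theorem exists_residual_estimate {Ω : Set Plane} {κ : Plane → Matrix (Fin 2) (Fin 2) ℝ}
    (hκ : IsDiffusionTensor Ω κ) (k m : ℕ) {c : ℝ} (hc : 0 < c) : ∃ C, 0 < C ∧
    ∀ (K : Polygon), K.IsRegular c → K.carrier ⊆ Ω → ∀ (σ : Plane → Plane) (u : Plane → ℝ),
      MemLp σ 2 (area Ω) → HasGradL2 Ω u (fun x => mulV (κ x)⁻¹ (σ x)) →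
      ∀ (p : Poly2) (s : VPoly2) (A : Matrix (Fin 2) (Fin 2) Poly2), DegLT (k + 1) p →
      VDegLT (k + 2) s → (∀ a b, DegLT (m + 1) (A a b)) →
      K.diam ^ 2 * (∫ x in K.carrier, ‖vev (polyMulV A s) x - vev (polyGrad p) x‖ ^ 2) ≤
          C * localError κ K σ u p s A ∧
        K.diam ^ 2 * (∫ x in K.carrier, ‖mulV (κ x)⁻¹ (σ x) - vev (polyMulV A s) x‖ ^ 2) ≤
          C * localError κ K σ u p s A := by
  obtain ⟨α, hα, hpos⟩ := hκ.posDef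
  obtain ⟨C₁, hC₁, hint⟩ := exists_interior_estimate (m + k + 1) hc
  have hα2 : 0 < 2 + 2 * (α⁻¹) ^ 2 := by positivity
  refine ⟨(1 + C₁) * (2 + 2 * (α⁻¹) ^ 2), by positivity, ?_⟩
  intro K hK hKΩ σ u hσ hu p s A hp hs hA
  obtain ⟨-, b, hb, hstar⟩ := hK
  have hKb := K.isBounded
  have hh := K.diam_pos
  have huK := hu.mono hKΩ
  have hpK : HasGradL2 K.carrier (ev p) (vev (polyGrad p)) := by
    have := (smooth_ev p).hasGradL2 hKb
    rwa [show gradient (ev p) = vev (polyGrad p) from funext (gradient_ev p)] at this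
  have hd := huK.sub hpK
  have mσ : MemLp σ 2 (area K.carrier) := hσ.mono_measure (Measure.restrict_mono hKΩ le_rfl)
  have ms : MemLp (vev s) 2 (area K.carrier) := memLp_of_continuous hKb (continuous_vev s)
  have mAs : MemLp (vev (polyMulV A s)) 2 (area K.carrier) :=
    memLp_of_continuous hKb (continuous_vev _)
  have m1 := hκ.memLp_mulV_inv hKΩ (mσ.sub ms)
  have m2 : MemLp (fun x => mulV (κ x)⁻¹ (vev s x) - vev (polyMulV A s) x) 2 (area K.carrier) :=
    (hκ.memLp_mulV_inv hKΩ ms).sub mAs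
  have m3 : MemLp (fun x => mulV (κ x)⁻¹ (σ x) - vev (polyMulV A s) x) 2 (area K.carrier) :=
    huK.2.1.sub mAs
  set E₁ := ∫ x in K.carrier, ‖σ x - vev s x‖ ^ 2 with hE₁
  set E₂ := ∫ x in K.carrier, ‖mulV (κ x)⁻¹ (vev s x) - vev (polyMulV A s) x‖ ^ 2 with hE₂
  set V := ∫ x in K.carrier, (u x - ev p x) ^ 2 with hV
  have hE₁0 : 0 ≤ E₁ := integral_nonneg fun x => sq_nonneg _
  have hE₂0 : 0 ≤ E₂ := integral_nonneg fun x => sq_nonneg _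
  have hV0 : 0 ≤ V := integral_nonneg fun x => sq_nonneg _
  have hle : localError κ K σ u p s A = K.diam ^ 2 * E₁ + K.diam ^ 2 * E₂ + V := rfl
  set D := ∫ x in K.carrier, ‖mulV (κ x)⁻¹ (σ x) - vev (polyMulV A s) x‖ ^ 2 with hDdef
  have hD : D ≤ 2 * (α⁻¹) ^ 2 * E₁ + 2 * E₂ := by
    have e1 : ∫ x in K.carrier, ‖mulV (κ x)⁻¹ ((σ - vev s) x)‖ ^ 2 ≤ (α⁻¹) ^ 2 * E₁ := by
      rw [hE₁, ← integral_const_mul]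
      refine integral_mono_ae m1.norm.integrable_sq ((mσ.sub ms).norm.integrable_sq.const_mul _) ?_
      filter_upwards [ae_restrict_of_ae_restrict_of_subset hKΩ hpos] with x hx
      rw [← mul_pow]
      gcongr
      exact norm_mulV_inv_le hα hx _
    have e2 := setIntegral_norm_add_sq_le m1 m2
    have e3 : D = ∫ x in K.carrier, ‖mulV (κ x)⁻¹ ((σ - vev s) x) +
        (mulV (κ x)⁻¹ (vev s x) - vev (polyMulV A s) x)‖ ^ 2 := by
      refine integral_congr_ae (ae_of_all _ fun x => ?_)
      simp only [Pi.sub_apply, mulV_sub, sub_add_sub_cancel]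
    rw [← e3] at e2
    linarith
  have hD0 : 0 ≤ D := integral_nonneg fun x => sq_nonneg _
  have hhD : K.diam ^ 2 * D ≤ (2 + 2 * (α⁻¹) ^ 2) * (K.diam ^ 2 * E₁ + K.diam ^ 2 * E₂) := by
    calc K.diam ^ 2 * D ≤ K.diam ^ 2 * (2 * (α⁻¹) ^ 2 * E₁ + 2 * E₂) := by gcongr
      _ ≤ K.diam ^ 2 * ((2 + 2 * (α⁻¹) ^ 2) * (E₁ + E₂)) := by
          gcongr
          nlinarith [mul_nonneg (sq_nonneg α⁻¹) hE₂0]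
      _ = _ := by ring
  have hI : ∀ i, K.diam ^ 2 * ∫ x in K.carrier, (vev (polyMulV A s) x - vev (polyGrad p) x) i ^ 2 ≤
      C₁ * (K.diam ^ 2 * (∫ x in K.carrier,
        (mulV (κ x)⁻¹ (σ x) - vev (polyMulV A s) x) i ^ 2) + V) := by
    intro i
    have := hint b K.diam hh K.carrier K.isOpen
      (fun y hy => by
        simpa using hstar y hy hb (a := 1) (b := 0) zero_le_one le_rfl (by simp))
      (K.subset_closedBall hb) _ _ hd (polyMulV A s i - polyGrad p i)
      (totalDegree_residual_le hA hs hp i) i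
    have e1 : ∀ x, ev (polyMulV A s i - polyGrad p i) x =
        (vev (polyMulV A s) x - vev (polyGrad p) x) i := fun x => by simp [ev, vev]
    have e2 : ∀ x, (ev (polyMulV A s i - polyGrad p i) x -
        (mulV (κ x)⁻¹ (σ x) - vev (polyGrad p) x) i) ^ 2 =
        (mulV (κ x)⁻¹ (σ x) - vev (polyMulV A s) x) i ^ 2 := fun x => by
      rw [e1]; simp only [PiLp.sub_apply]; ring
    simp only [e2] at this
    simpa only [e1] using this
  have hsum : K.diam ^ 2 * (∫ x in K.carrier,
      ‖vev (polyMulV A s) x - vev (polyGrad p) x‖ ^ 2) ≤ C₁ * (K.diam ^ 2 * D + 2 * V) := by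
    rw [setIntegral_norm_sq (F := fun x => vev (polyMulV A s) x - vev (polyGrad p) x)
      (mAs.sub hpK.2.1), hDdef, setIntegral_norm_sq m3]
    have h0 := hI 0
    have h1 := hI 1
    simp only at h0 h1 ⊢
    linarith
  rw [hle]
  set X := K.diam ^ 2 * E₁ + K.diam ^ 2 * E₂ with hX
  have hX0 : 0 ≤ X := by positivity
  have hβ : 0 ≤ (α⁻¹) ^ 2 := sq_nonneg _
  have hstep : K.diam ^ 2 * D + 2 * V ≤ (2 + 2 * (α⁻¹) ^ 2) * (X + V) := by
    nlinarith [mul_nonneg hβ hV0]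
  have hnn : 0 ≤ (2 + 2 * (α⁻¹) ^ 2) * (X + V) := by positivity
  refine ⟨?_, ?_⟩
  · calc _ ≤ C₁ * (K.diam ^ 2 * D + 2 * V) := hsum
      _ ≤ C₁ * ((2 + 2 * (α⁻¹) ^ 2) * (X + V)) := by gcongr
      _ ≤ _ := by nlinarith
  · calc _ ≤ (2 + 2 * (α⁻¹) ^ 2) * (X + V) := by linarith
      _ ≤ _ := by nlinarith [mul_nonneg hC₁.le hnn]

/-- The trace estimate on an edge on `ΓD` of a regular polygon. -/
theorem edge_estimate {Ω ΓD : Set Plane} {κ : Plane → Matrix (Fin 2) (Fin 2) ℝ}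
    (hκ : IsDiffusionTensor Ω κ) {f g : Plane → ℝ} (hg : InHHalf Ω ΓD g) {σ : Plane → Plane}
    {dσ u : Plane → ℝ} (hsol : IsMixedSolution Ω ΓD κ f g σ dσ u) (hΩ : IsOpen Ω)
    (hb : Bornology.IsBounded Ω) (hΓ : ΓD ⊆ frontier Ω) {c : ℝ} (hc : 0 < c) {K : Polygon}
    (hK : K.IsRegular c) (hKΩ : K.carrier ⊆ Ω) {i : Fin (K.extra + 3)} (hi : K.openEdge i ⊆ ΓD)
    (p : Poly2) :
    K.edgeLength i * (∫ x, (g x - ev p x) ^ 2 ∂(arc (K.edge i))) ≤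
      2 / c * (4 / 3 * (K.diam ^ 2 *
        (∫ x in K.carrier, ‖mulV (κ x)⁻¹ (σ x) - vev (polyGrad p) x‖ ^ 2) +
        4 * ∫ x in K.carrier, (u x - ev p x) ^ 2)) := by
  obtain ⟨hlen, b, hbK, hstar⟩ := hK
  have hh := K.diam_pos
  set L := K.edgeLength i with hL
  have hL0 : 0 < L := (mul_pos hc hh).trans_le (hlen i)
  set v := K.vertex i with hv
  set e := L⁻¹ • (K.vertex (i + 1) - v) with he
  have he1 : ‖e‖ = 1 := by
    rw [he, norm_smul, ← dist_eq_norm, dist_comm, norm_inv, Real.norm_of_nonneg hL0.le]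
    exact inv_mul_cancel₀ hL0.ne'
  have hline : (fun s : ℝ => v + s • e) '' Set.Ioo 0 L = K.openEdge i := by
    refine image_line_eq_openSegment hL0 ?_
    rw [he, smul_smul, mul_inv_cancel₀ hL0.ne', one_smul, add_sub_cancel]
  obtain ⟨a, ha, hheight⟩ := exists_apex b v he1 (mul_pos hc hh)
  have hcross : cross (v - a) e ≠ 0 := by
    intro h0
    rw [h0, abs_zero] at hheight
    nlinarith [mul_pos hc hh]
  have haK : a ∈ K.carrier := by
    simpa using hstar a ha hbK (a := 1) (b := 0) zero_le_one le_rfl (by simp)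
  have hT : coneSet a v e L ⊆ K.carrier := by
    refine coneSet_subset hstar ha hcross ?_
    rw [hline]
    exact ((openSegment_subset_segment ℝ _ _).trans (K.segment_subset_frontier i)).trans
      frontier_subset_closure
  have hest := boundary_estimate hκ hg hsol hΩ hb hKΩ hT hcross he1 (hline ▸ hi) hΓ
    (R := K.diam) (fun x hx => by
      rw [← dist_eq_norm]; exact K.subset_closedBall haK (hT hx)) p
  set B := 4 / 3 * (K.diam ^ 2 *
        (∫ x in K.carrier, ‖mulV (κ x)⁻¹ (σ x) - vev (polyGrad p) x‖ ^ 2) +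
        4 * ∫ x in K.carrier, (u x - ev p x) ^ 2) with hB
  have harc : ∫ x, (g x - ev p x) ^ 2 ∂(arc (K.edge i)) =
      ∫ s in Set.Ioo 0 L, (g (v + s • e) - ev p (v + s • e)) ^ 2 := by
    rw [Polygon.edge, arc_segment, ← Polygon.openEdge, ← hline, ← map_line v he1,
      (measurableEmbedding_line v he1).integral_map]
  rw [harc]
  set J := ∫ s in Set.Ioo 0 L, (g (v + s • e) - ev p (v + s • e)) ^ 2 with hJ
  have hJ0 : 0 ≤ J := integral_nonneg fun x => sq_nonneg _
  -- the height of the triangle is at least half the radius of the disc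
  calc L * J ≤ K.diam * J := by gcongr; exact K.edgeLength_le_diam i
    _ = 2 / c * ((c * K.diam) / 2 * J) := by field_simp
    _ ≤ 2 / c * (|cross (v - a) e| * J) := by gcongr
    _ ≤ 2 / c * B := by gcongr

end MixedVEM

theorem mainTheorem4
    (Ω ΓD ΓN : Set Plane) (hΩ : IsPolygonalDomain Ω) (hΓ : IsBoundaryPartition Ω ΓD ΓN)
    (κ : Plane → Matrix (Fin 2) (Fin 2) ℝ) (hκ : IsDiffusionTensor Ω κ)
    (k m : ℕ) (CT c₀ c₁ : ℝ) (hCT : 0 < CT) (hc₀ : 0 < c₀) (hc₁ : 0 < c₁) :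
    ∃ C : ℝ, 0 < C ∧
      ∀ (f g : Plane → ℝ), MemLp f 2 (area Ω) → InHHalf Ω ΓD g →
      ∀ (σ : Plane → Plane) (dσ u : Plane → ℝ), IsMixedSolution Ω ΓD κ f g σ dσ u →
      ∀ (T : Mesh Ω ΓD ΓN), T.IsRegular CT →
      ∀ (S : Fin T.card → (Plane → Plane) → (Plane → Plane) → ℝ),
        (∀ j, IsStabilisation κ k (T.elem j) c₀ c₁ (S j)) →
      ∀ (σh : Plane → Plane) (dh : Plane → ℝ) (uh : Fin T.card → Poly2),
        IsVEMSolution κ k T S f g σh dh uh →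
      ∀ (σs : Fin T.card → VPoly2), (∀ j, IsPostprocessedFlux k (T.elem j) σh dh (σs j)) →
      ∀ (κh : Fin T.card → Matrix (Fin 2) (Fin 2) Poly2),
        (∀ j a b, DegLT (m + 1) (κh j a b)) →
      ∀ j : Fin T.card,
        (T.elem j).diam ^ 2 *
            (∫ x in (T.elem j).carrier,
              ‖vev (polyMulV (κh j) (σs j)) x - vev (polyGrad (uh j)) x‖ ^ 2) ≤
          C * localError κ (T.elem j) σ u (uh j) (σs j) (κh j) ∧
        ∀ i, (T.elem j).openEdge i ⊆ ΓD →
          (T.elem j).edgeLength i *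
              (∫ x, (g x - ev (uh j) x) ^ 2 ∂(arc ((T.elem j).edge i))) ≤
            C * localError κ (T.elem j) σ u (uh j) (σs j) (κh j) := by
  obtain ⟨C, hC, hres⟩ := exists_residual_estimate hκ k m hCT
  refine ⟨C + 2 / CT * (4 / 3 * (4 * C + 4)), by positivity, ?_⟩
  intro f g _ hg σ dσ u hsol T hT S _ σh dh uh hvem σs hσs κh hκh j
  have hΩb := hΩ.isBounded
  have hu := hsol.hasGradL2 hΩb hκ hg
  have hKΩ := T.elem_subset hΩ j
  obtain ⟨h1, h2⟩ := hres (T.elem j) (hT j) hKΩ σ u hsol.flux_mem.1.1 hu (uh j) (σs j) (κh j)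
    (hvem.scalar_mem j) (hσs j).1 (hκh j)
  set K := T.elem j with hK
  set E := localError κ K σ u (uh j) (σs j) (κh j) with hE
  have i1 : 0 ≤ ∫ x in K.carrier, ‖σ x - vev (σs j) x‖ ^ 2 := integral_nonneg fun x => sq_nonneg _
  have i2 : 0 ≤ ∫ x in K.carrier,
      ‖mulV (κ x)⁻¹ (vev (σs j) x) - vev (polyMulV (κh j) (σs j)) x‖ ^ 2 :=
    integral_nonneg fun x => sq_nonneg _
  have i3 : 0 ≤ ∫ x in K.carrier, (u x - ev (uh j) x) ^ 2 := integral_nonneg fun x => sq_nonneg _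
  have hV : ∫ x in K.carrier, (u x - ev (uh j) x) ^ 2 ≤ E := by
    rw [hE, localError]
    have := mul_nonneg (sq_nonneg K.diam) i1
    have := mul_nonneg (sq_nonneg K.diam) i2
    linarith
  have hE0 : 0 ≤ E := i3.trans hV
  have hB0 : 0 ≤ 2 / CT * (4 / 3 * (4 * C + 4)) := by positivity
  refine ⟨h1.trans (mul_le_mul_of_nonneg_right (by linarith) hE0), fun i hi => ?_⟩
  have hΓD : ΓD ⊆ frontier Ω := by
    obtain ⟨U, -, rfl⟩ := hΓ.openD
    exact Set.inter_subset_left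
  have hedge := edge_estimate hκ hg hsol hΩ.isOpen hΩb hΓD hCT (hT j) hKΩ hi (uh j)
  have mAs : MemLp (vev (polyMulV (κh j) (σs j))) 2 (area K.carrier) :=
    memLp_of_continuous K.isBounded (continuous_vev _)
  have mD := (hu.mono hKΩ).2.1.sub mAs
  have mP := mAs.sub (memLp_of_continuous K.isBounded (continuous_vev (polyGrad (uh j))))
  have hsplit := setIntegral_norm_add_sq_le mD mP
  simp only [Pi.sub_apply, sub_add_sub_cancel] at hsplit
  have h3 := mul_le_mul_of_nonneg_left hsplit (sq_nonneg K.diam)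
  calc _ ≤ _ := hedge
    _ ≤ 2 / CT * (4 / 3 * ((4 * C + 4) * E)) := by
        gcongr
        linarith
    _ ≤ _ := by nlinarith [mul_nonneg hC.le hE0]
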